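/- The following is a theorem of ZF set theory (no form of the Axiom of Choice is assumed); equivalently, it holds in every model of ZF. Definitions. A set is finite if it is equipotent with a natural number, and infinite otherwise; it is Dedekind-finite if every injection of it into itself is surjective. A set $X$ is CF if $X$ is infinite and the set of all finite subsets of $X$ is Dedekind-finite. An infinite set $X$ is strongly amorphous if every subset of $X$ is finite or has finite complement in $X$, and in every partition of $X$ into nonempty subsets all but finitely many cells are singletons. For a set $X$, $\ell^2(X)$ is the space of all functions $\eta\colon X\to\mathbb{C}$ for which the sums $\sum_{x\in F}|\eta(x)|^2$ over finite $F\subseteq X$ are bounded, with the inner product $\langle\eta,\zeta\rangle=\lim_F\sum_{x\in F}\eta(x)\overline{\zeta(x)}$ (the limit being over the finite $F\subseteq X$ directed by inclusion); $\xi_x$ is the indicator function of $\{x\}$; for $A\subseteq X$, $\ell^2(A)$ is identified with the set of vectors in $\ell^2(X)$ that vanish outside $A$. A unitary is a linear bijection that preserves the inner product. Theorem. Let $X$ and $Y$ be sets, let $X$ be CF, and let $U\colon\ell^2(X)\to\ell^2(Y)$ be a unitary. (i) There are a set $Z$ and partitions $X=\bigsqcup_{z\in Z}X_z$ and $Y=\bigsqcup_{z\in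 Z}Y_z$ into nonempty finite sets such that $U[\ell^2(X_z)]=\ell^2(Y_z)$, and hence $|X_z|=|Y_z|$, for all $z\in Z$. (ii) If $X$ is in addition strongly amorphous, then $|X|=|Y|$, and there are cofinite sets $X'\subseteq X$ and $Y'\subseteq Y$, a bijection $f\colon X'\to Y'$ and a single $c\in\mathbb{C}$ with $|c|=1$ such that $U\xi_x=c\,\xi_{f(x)}$ for all $x\in X'$. -/

import Mathlib

/-!
The result is a theorem of ZF set theory without any form of choice, about sets whose existence
contradicts choice. It is therefore stated as a theorem about an arbitrary model of ZF: a type `M`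
with a membership relation that satisfies the first-order axioms of ZF (Lean's own choice axiom
says nothing about the sets and functions which are elements of `M`). All the objects, and all the
quantifiers over sets, functions, families and operators, are those of the model.
-/

universe u v w

namespace ZFModel

/-! ### The axioms of ZF -/

/-- The only symbol of the language of set theory: a binary relation, membership. -/
inductive MemRel : ℕ → Type
  | mem : MemRel 2

/-- The first-order language of set theory. -/
def setLanguage : FirstOrder.Language.{0, 0} := ⟨fun _ => Empty, MemRel⟩

instance instStructure (M : Type u) [Membership M M] : setLanguage.Structure M where
  funMap := fun f => Empty.elim f
  RelMap := fun {n} r v =>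
    match n, r, v with
    | _, MemRel.mem, v => v 0 ∈ v 1

/-- `(M, ∈)` is a model of Zermelo--Fraenkel set theory, without choice. The two schemes range over
the first-order formulas in the language of set theory with arbitrary parameters from `M`. -/
class IsZF (M : Type u) [Membership M M] : Prop where
  extensionality : ∀ a b : M, (∀ x, x ∈ a ↔ x ∈ b) → a = b
  foundation : ∀ a : M, (∃ x, x ∈ a) → ∃ x, x ∈ a ∧ ∀ y, y ∈ x → ¬ y ∈ a
  pairing : ∀ a b : M, ∃ c : M, ∀ x, x ∈ c ↔ x = a ∨ x = b
  union : ∀ a : M, ∃ b : M, ∀ x, x ∈ b ↔ ∃ y, y ∈ a ∧ x ∈ y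
  powerset : ∀ a : M, ∃ b : M, ∀ x, x ∈ b ↔ ∀ y, y ∈ x → y ∈ a
  infinity : ∃ a : M, (∃ e, e ∈ a ∧ ∀ x, ¬ x ∈ e) ∧
    ∀ n, n ∈ a → ∃ s, s ∈ a ∧ ∀ x, x ∈ s ↔ x ∈ n ∨ x = n
  separation : ∀ P : M → Prop, (Set.univ : Set M).Definable₁ setLanguage {x | P x} →
    ∀ a : M, ∃ b : M, ∀ x, x ∈ b ↔ x ∈ a ∧ P x
  replacement : ∀ P : M → M → Prop,
    (Set.univ : Set M).Definable₂ setLanguage {q : M × M | P q.1 q.2} →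
    ∀ a : M, (∀ x, x ∈ a → ∃! y, P x y) → ∃ b : M, ∀ y, y ∈ b ↔ ∃ x, x ∈ a ∧ P x y

section

variable {M : Type u} [Membership M M] [IsZF M]

/-- The unordered pair `{a, b}` in the model. -/
noncomputable def upair (a b : M) : M := Classical.choose (IsZF.pairing a b)

theorem mem_upair {a b x : M} : x ∈ upair a b ↔ x = a ∨ x = b :=
  Classical.choose_spec (IsZF.pairing a b) x

theorem upair_eq {a b c d : M} (h : upair a b = upair c d) :
    (a = c ∧ b = d) ∨ (a = d ∧ b = c) := by
  have ha : a = c ∨ a = d := mem_upair.1 (h ▸ mem_upair.2 (Or.inl rfl))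
  have hb : b = c ∨ b = d := mem_upair.1 (h ▸ mem_upair.2 (Or.inr rfl))
  have hc : c = a ∨ c = b := mem_upair.1 (h.symm ▸ mem_upair.2 (Or.inl rfl))
  have hd : d = a ∨ d = b := mem_upair.1 (h.symm ▸ mem_upair.2 (Or.inr rfl))
  grind

/-- The Kuratowski ordered pair `{{a}, {a, b}}` in the model. -/
noncomputable def pair (a b : M) : M := upair (upair a a) (upair a b)

theorem pair_inj {a b c d : M} (h : pair a b = pair c d) : a = c ∧ b = d := by
  rcases upair_eq h with ⟨h1, h2⟩ | ⟨h1, h2⟩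
  · have := upair_eq h1
    have := upair_eq h2
    grind
  · have := upair_eq h1
    have := upair_eq h2
    grind

end

/-! ### Sets and functions of the model

A type is *coded* when its members are represented by distinct elements of the model. A set of
members of a coded type, or a function between coded types, is *internal* when it is (represented
by) an element of the model. -/

/-- The members of the set `a` of the model. -/
def Elt {M : Type u} [Membership M M] (a : M) : Type u := {x : M // x ∈ a}

/-- Representation of the members of `α` by elements of the model `M`. -/
class Coded (M : Type u) (α : Type v) where
  code : α → M
  code_injective : Function.Injective code

instance Coded.elt {M : Type u} [Membership M M] (a : M) : Coded M (Elt a) :=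
  ⟨fun x => x.1, Subtype.val_injective⟩

instance Coded.subtype (M : Type u) {α : Type v} [Coded M α] (p : α → Prop) :
    Coded M {a : α // p a} :=
  ⟨fun a => Coded.code a.1, fun _ _ h => Subtype.ext (Coded.code_injective h)⟩

section

variable (M : Type u) [Membership M M]

/-- The collection `S` of members of `α` is a set of the model. -/
def IsInternalSet {α : Type v} [Coded M α] (S : Set α) : Prop :=
  ∃ s : M, ∀ m : M, m ∈ s ↔ ∃ a ∈ S, Coded.code a = m

theorem choose_eq_imp {α : Type v} [Coded M α] {S T : Set α}
    (hS : IsInternalSet M S) (hT : IsInternalSet M T)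
    (h : Classical.choose hS = Classical.choose hT) : S = T := by
  ext a
  have h1 := Classical.choose_spec hS (Coded.code a)
  have h2 := Classical.choose_spec hT (Coded.code a)
  rw [h] at h1
  have key : ∀ U : Set α, (∃ b ∈ U, (Coded.code b : M) = Coded.code a) ↔ a ∈ U := fun U =>
    ⟨fun ⟨b, hb, hab⟩ => Coded.code_injective hab ▸ hb, fun ha => ⟨a, ha, rfl⟩⟩
  rw [← key S, ← key T, ← h1, ← h2]

variable [IsZF M]

/-- Ordered pairs are represented by Kuratowski pairs. -/
noncomputable instance Coded.prod {α : Type v} {β : Type w} [Coded M α] [Coded M β] :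
    Coded M (α × β) :=
  ⟨fun p => pair (Coded.code p.1) (Coded.code p.2), fun _ _ h =>
    Prod.ext (Coded.code_injective (pair_inj h).1) (Coded.code_injective (pair_inj h).2)⟩

/-- The members of a quadratic algebra (below: the complex numbers) are represented by the pairs
of their coordinates. -/
noncomputable instance Coded.quadratic {α : Type v} [Coded M α] (a b : α) :
    Coded M (QuadraticAlgebra α a b) :=
  ⟨fun z => pair (Coded.code z.re) (Coded.code z.im), fun _ _ h =>
    QuadraticAlgebra.ext (Coded.code_injective (pair_inj h).1)
      (Coded.code_injective (pair_inj h).2)⟩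

/-- The function `f` is a function of the model: its graph is a set of the model. -/
def IsInternalFun {α : Type v} {β : Type w} [Coded M α] [Coded M β] (f : α → β) : Prop :=
  IsInternalSet M {p : α × β | p.2 = f p.1}

/-- The sets of members of `α` which belong to the model. -/
def IntSet (α : Type v) [Coded M α] : Type v := {S : Set α // IsInternalSet M S}

/-- The functions from `α` to `β` which belong to the model. -/
def IntFun (α : Type v) (β : Type w) [Coded M α] [Coded M β] : Type (max v w) :=
  {f : α → β // IsInternalFun M f}

instance {α : Type v} {β : Type w} [Coded M α] [Coded M β] :
    CoeFun (IntFun M α β) (fun _ => α → β) := ⟨fun f => f.1⟩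

instance {α : Type v} [Coded M α] : Membership α (IntSet M α) := ⟨fun S a => a ∈ S.1⟩

/-- A set of the model is represented by itself, i.e. by the element of `M` whose members are the
representatives of its members. -/
noncomputable instance Coded.intSet {α : Type v} [Coded M α] : Coded M (IntSet M α) :=
  ⟨fun S => Classical.choose S.2, fun S T h => Subtype.ext (choose_eq_imp M S.2 T.2 h)⟩

/-- A function of the model is represented by its graph. -/
noncomputable instance Coded.intFun {α : Type v} {β : Type w} [Coded M α] [Coded M β] :
    Coded M (IntFun M α β) :=
  ⟨fun f => Classical.choose f.2, fun f g h => Subtype.ext <| funext fun a => by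
    have := choose_eq_imp M f.2 g.2 h
    have h1 : (a, f.1 a) ∈ {p : α × β | p.2 = f.1 p.1} := rfl
    rw [this] at h1
    exact h1⟩

/-- `|S| = |T|` in the model. -/
def Equipotent {α : Type v} {β : Type w} [Coded M α] [Coded M β] (S : Set α) (T : Set β) : Prop :=
  ∃ f : S → T, IsInternalFun M f ∧ Function.Bijective f

variable {M}

/-- `n` is a natural number (finite von Neumann ordinal) of the model: it belongs to every set
which contains `∅` and is closed under `k ↦ k ∪ {k}`. -/
def IsNat (n : M) : Prop :=
  ∀ a : M, (∀ e, (∀ x, ¬ x ∈ e) → e ∈ a) →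
    (∀ k, k ∈ a → ∀ s, (∀ x, x ∈ s ↔ x ∈ k ∨ x = k) → s ∈ a) → n ∈ a

variable (M)

/-- `S` is finite in the model: equipotent with a natural number of the model. -/
def IsFinite {α : Type v} [Coded M α] (S : Set α) : Prop :=
  ∃ n : M, IsNat n ∧ Equipotent M (Set.univ : Set (Elt n)) S

/-- `Fin(α)`, the finite sets of members of `α` in the model. -/
abbrev FinSub (α : Type v) [Coded M α] : Type v := {S : IntSet M α // IsFinite M S.1}

/-- In the model, every injective function from `α` to `α` is surjective. -/
def IsDedekindFinite (α : Type v) [Coded M α] : Prop :=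
  ∀ f : α → α, IsInternalFun M f → Function.Injective f → Function.Surjective f

variable {M}

/-- `X` is CF: infinite and Cohen-finite, i.e. `Fin(X)` is Dedekind-finite. -/
def IsCF (X : M) : Prop :=
  ¬ IsFinite M (Set.univ : Set (Elt X)) ∧ IsDedekindFinite M (FinSub M (Elt X))

/-- `X` is infinite and each of its subsets is finite or cofinite. -/
def IsAmorphous (X : M) : Prop :=
  ¬ IsFinite M (Set.univ : Set (Elt X)) ∧
    ∀ S : IntSet M (Elt X), IsFinite M S.1 ∨ IsFinite M (S.1)ᶜ

/-- `P` is a partition of `X` into nonempty subsets. -/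
def IsPartition {X : M} (P : IntSet M (IntSet M (Elt X))) : Prop :=
  (∀ C ∈ P, C.1.Nonempty) ∧ ∀ x : Elt X, ∃! C, C ∈ P ∧ x ∈ C

/-- `X` is infinite, and in any partition of `X` into nonempty subsets all but finitely many cells
are singletons. -/
def IsStronglyRigid (X : M) : Prop :=
  ¬ IsFinite M (Set.univ : Set (Elt X)) ∧
    ∀ P : IntSet M (IntSet M (Elt X)), IsPartition P →
      IsFinite M {C | C ∈ P ∧ ¬ ∃ x : Elt X, C.1 = {x}}

/-- `X` is strongly amorphous. -/
def IsStronglyAmorphous (X : M) : Prop := IsAmorphous X ∧ IsStronglyRigid X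

/-- `X = ⨆ A_z`, a disjoint union of nonempty sets indexed by `z ∈ Z`. -/
def IsPartitionFamily {X Z : M} (A : IntFun M (Elt Z) (IntSet M (Elt X))) : Prop :=
  (∀ z, (A z).1.Nonempty) ∧ ∀ x : Elt X, ∃! z, x ∈ A z

/-! ### Real and complex numbers of the model -/

/-- The set `R` of the model, with the given operations and order, is the field of real numbers of
the model: the ordered field `R` belongs to the model and every nonempty bounded subset of `R` in
the model has a supremum. In ZF there is such an ordered field, and it is unique up to a unique
isomorphism. -/
structure IsRealField (R : M) [Field (Elt R)] [LinearOrder (Elt R)]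
    [IsStrictOrderedRing (Elt R)] : Prop where
  add_internal : IsInternalFun M (fun p : Elt R × Elt R => p.1 + p.2)
  mul_internal : IsInternalFun M (fun p : Elt R × Elt R => p.1 * p.2)
  le_internal : IsInternalSet M {p : Elt R × Elt R | p.1 ≤ p.2}
  exists_isLUB : ∀ A : Set (Elt R), IsInternalSet M A → A.Nonempty → BddAbove A →
    ∃ s, IsLUB A s

/-- The complex numbers `R[i]`, `i² = -1`, over the real numbers `R`. Here `star` is complex
conjugation and `QuadraticAlgebra.norm z = z.re ^ 2 + z.im ^ 2` is the square of the modulus. -/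
abbrev Cpx (R : M) [Field (Elt R)] : Type u := QuadraticAlgebra (Elt R) (-1) 0

/-! ### The Hilbert space `ℓ²(X)` -/

/-- `S` is the function `F ↦ ∑_{x ∈ F} g x` on the finite sets of the model. -/
structure IsFinSum {α : Type v} {β : Type w} [Coded M α] [Coded M β] [AddCommMonoid β]
    (g : α → β) (S : FinSub M α → β) : Prop where
  internal : IsInternalFun M S
  empty : ∀ F, F.1.1 = ∅ → S F = 0
  insert : ∀ F G a, a ∉ F.1.1 → G.1.1 = Set.insert a F.1.1 → S G = S F + g a

section

variable (R : M) [Field (Elt R)] [LinearOrder (Elt R)]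

/-- `∑_{x ∈ X} |η x|² < ∞`: the sums over the finite subsets of `X` are bounded. -/
def SquareSummable {X : M} (η : Elt X → Cpx R) : Prop :=
  ∃ S : FinSub M (Elt X) → Elt R,
    IsFinSum (fun x => QuadraticAlgebra.norm (η x)) S ∧ BddAbove (Set.range S)

/-- `ℓ²(X)` in the model. -/
def L2 (X : M) : Type u := {η : IntFun M (Elt X) (Cpx R) // SquareSummable R η.1}

noncomputable instance (X : M) : Coded M (L2 R X) :=
  inferInstanceAs (Coded M {η : IntFun M (Elt X) (Cpx R) // SquareSummable R η.1})

instance (X : M) : CoeFun (L2 R X) (fun _ => Elt X → Cpx R) := ⟨fun η => η.1.1⟩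

variable {R} {X Y : M}

/-- `⟨η, ζ⟩ = c`: the net of the sums `∑_{x ∈ F} η x * conj (ζ x)`, over the finite subsets `F`
of `X` directed by inclusion, converges to `c`. -/
def HasInner (η ζ : L2 R X) (c : Cpx R) : Prop :=
  ∃ S : FinSub M (Elt X) → Cpx R, IsFinSum (fun x => η x * star (ζ x)) S ∧
    ∀ ε : Elt R, 0 < ε → ∃ F₀ : FinSub M (Elt X), ∀ F : FinSub M (Elt X), F₀.1.1 ⊆ F.1.1 →
      QuadraticAlgebra.norm (S F - c) < ε ^ 2

/-- `U` is a unitary from `ℓ²(X)` to `ℓ²(Y)` in the model: a linear bijection which preserves the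
inner product. -/
structure IsUnitary (U : L2 R X → L2 R Y) : Prop where
  internal : IsInternalFun M U
  add : ∀ η ζ θ : L2 R X, (∀ x, θ x = η x + ζ x) → ∀ y, U θ y = U η y + U ζ y
  smul : ∀ (a : Cpx R) (η θ : L2 R X), (∀ x, θ x = a * η x) → ∀ y, U θ y = a * U η y
  inner : ∀ (η ζ : L2 R X) (c : Cpx R), HasInner η ζ c → HasInner (U η) (U ζ) c
  bijective : Function.Bijective U

/-- `ξ` is the standard basis vector `ξ_x` of `ℓ²(X)`. -/
def IsBasisVector (x : Elt X) (ξ : L2 R X) : Prop := ξ x = 1 ∧ ∀ x', x' ≠ x → ξ x' = 0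

variable (R)

/-- `ℓ²(A)` for `A ⊆ X`, as a subspace of `ℓ²(X)`: the vectors supported in `A`. -/
def L2On (A : Set (Elt X)) : Set (L2 R X) := {η | ∀ x, x ∉ A → η x = 0}

end

end

end ZFModel

open ZFModel

-- Let w(x,y) be the squared modulus of the y-coordinate of Uξ_x. Rows of w have partial sums at
-- most 1, column sums are bounded because the y-th column is the conjugate of U⁻¹ξ_y, and a row or
-- column with finite support has sum exactly 1. Link two rows when both are nonzero in a common
-- column. The sets X_z are the components of this graph, and Y_z consists of the columns that X_z
-- meets.
--
-- Components are finite because X is CF. If Fin(X) is Dedekind-finite, a nonempty definable chain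
-- of finite sets has a greatest member, since otherwise the successor map along the chain would be
-- injective and miss the least member (`exists_greatest_of_chain`). For fixed ε > 0, only entries
-- of size at least ε are used for links. Each row then has finitely many neighbours, and the chain
-- of iterated neighbourhoods stabilises at a finite closed set (`exists_finite_closed`). As ε
-- decreases, the ε-components of x form a second chain of finite sets, and its greatest member
-- contains the whole component (`isFinite_sameBlock`). Summing w over a closed finite set of rows
-- in both orders gives |X_z| = |Y_z| (`exists_equipotent_of_closed`), and U respects the blocks
-- because ⟨Uη, ξ_y⟩ = ⟨η, U⁻¹ξ_y⟩ (`image_L2On`).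
--
-- If X is strongly amorphous, almost all components are singletons, where Uξ_x is a multiple of one
-- basis vector. The real and imaginary parts of the multiplier are bounded functions on an
-- amorphous CF set, so they are constant off a finite set, again by the chain lemma
-- (`exists_isFinite_ne`). The exceptional rows form a union of components, so double counting
-- matches them with the exceptional columns.
--
-- Every set used must belong to the model, hence be cut out by a first-order formula. `Dfn` handles
-- formulas, and `IsInternalFun` with `fun_prop` derives internality from the shape of an
-- expression. Choices made outside the model serve only individual assertions or are unique, and
-- then definable.

universe x

namespace ZFModel

set_option linter.unusedSectionVars false
set_option linter.unusedVariables false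

/-! ### Definable predicates -/

section

variable {M : Type u} [Membership M M]

/-- `P` is a predicate of valuations that is definable with parameters. -/
def Dfn (P : (ℕ → M) → Prop) : Prop :=
  (Set.univ : Set M).Definable setLanguage {v : ℕ → M | P v}

theorem Dfn.and {P Q : (ℕ → M) → Prop} (hP : Dfn P) (hQ : Dfn Q) : Dfn fun v => P v ∧ Q v :=
  Set.Definable.inter hP hQ

theorem Dfn.or {P Q : (ℕ → M) → Prop} (hP : Dfn P) (hQ : Dfn Q) : Dfn fun v => P v ∨ Q v :=
  Set.Definable.union hP hQ

theorem Dfn.not {P : (ℕ → M) → Prop} (hP : Dfn P) : Dfn fun v => ¬ P v :=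
  Set.Definable.compl hP

theorem Dfn.congr {P Q : (ℕ → M) → Prop} (hP : Dfn P) (h : ∀ v, P v ↔ Q v) : Dfn Q := by
  have : P = Q := funext fun v => propext (h v)
  exact this ▸ hP

theorem Dfn.iff {P Q : (ℕ → M) → Prop} (hP : Dfn P) (hQ : Dfn Q) : Dfn fun v => (P v ↔ Q v) :=
  ((hP.and hQ).or (hP.not.and hQ.not)).congr fun v => by tauto

/-- Valuations are indexed by all of ℕ, so a quantifier binds the coordinate `n` by updating it. The
separate `Q` lets the result be stated without `Function.update`. -/
theorem Dfn.ex {P : (ℕ → M) → Prop} {Q : (ℕ → M) → M → Prop} (n : ℕ) (hP : Dfn P)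
    (h : ∀ v a, P (Function.update v n a) ↔ Q v a) : Dfn fun v => ∃ a, Q v a := by
  obtain ⟨φ, hφ⟩ := hP
  have hφ' : ∀ v, φ.Realize v ↔ P v := fun v => (Set.ext_iff.1 hφ v).symm
  refine ⟨FirstOrder.Language.Formula.iExs Unit
    (φ.relabel fun k => if k = n then Sum.inr () else Sum.inl k), ?_⟩
  ext v
  simp only [Set.mem_ofPred_eq, FirstOrder.Language.Formula.realize_iExs,
    FirstOrder.Language.Formula.realize_relabel, hφ', ← h]
  have key : ∀ i : Unit → M,
      (Sum.elim v i ∘ fun k => if k = n then Sum.inr () else Sum.inl k) =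
        Function.update v n (i ()) := by
    intro i
    funext k
    by_cases hk : k = n
    · subst hk; simp
    · simp [hk]
  simp only [key]
  exact ⟨fun ⟨a, ha⟩ => ⟨fun _ => a, ha⟩, fun ⟨i, hi⟩ => ⟨i (), hi⟩⟩

theorem Dfn.all {P : (ℕ → M) → Prop} {Q : (ℕ → M) → M → Prop} (n : ℕ) (hP : Dfn P)
    (h : ∀ v a, P (Function.update v n a) ↔ Q v a) : Dfn fun v => ∀ a, Q v a :=
  (Dfn.ex (Q := fun v a => ¬ Q v a) n hP.not fun v a => not_congr (h v a)).not.congr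
    fun v => by simp

theorem Dfn.mem (i j : ℕ) : Dfn fun v : ℕ → M => v i ∈ v j := by
  let r : (setLanguage.withConstants (Set.univ : Set M)).Relations 2 := Sum.inl MemRel.mem
  refine ⟨r.formula ![FirstOrder.Language.Term.var i, FirstOrder.Language.Term.var j], ?_⟩
  ext v
  rw [Set.mem_ofPred_eq, Set.mem_ofPred_eq, FirstOrder.Language.Formula.realize_rel]
  rfl

theorem Dfn.eq (i j : ℕ) : Dfn fun v : ℕ → M => v i = v j := by
  refine ⟨FirstOrder.Language.Term.equal (FirstOrder.Language.Term.var i)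
    (FirstOrder.Language.Term.var j), ?_⟩
  ext v
  simp [FirstOrder.Language.Formula.realize_equal]

theorem Dfn.eqConst (i : ℕ) (c : M) : Dfn fun v : ℕ → M => v i = c := by
  refine ⟨FirstOrder.Language.Term.equal (FirstOrder.Language.Term.var i)
    (FirstOrder.Language.Constants.term
      (setLanguage.con (⟨c, trivial⟩ : (Set.univ : Set M)))), ?_⟩
  ext v
  simp [FirstOrder.Language.Formula.realize_equal]

theorem Dfn.memConst (i : ℕ) (c : M) : Dfn fun v : ℕ → M => v i ∈ c :=
  (Dfn.ex (Q := fun v a => a = c ∧ v i ∈ a) (i + 1)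
    ((Dfn.eqConst (i + 1) c).and (Dfn.mem i (i + 1)))
    fun v a => by simp [Function.update]).congr fun v => by simp

theorem Dfn.definable₁ {P : M → Prop} (hP : Dfn fun v : ℕ → M => P (v 0)) :
    (Set.univ : Set M).Definable₁ setLanguage {m | P m} :=
  Set.Definable.preimage_comp (fun _ : ℕ => (0 : Fin 1)) hP

variable [IsZF M]

theorem ext_mem {a b : M} (h : ∀ m, m ∈ a ↔ m ∈ b) : a = b := IsZF.extensionality a b h

theorem Dfn.eqUpair (i j k : ℕ) : Dfn fun v : ℕ → M => v i = upair (v j) (v k) := by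
  have hi : i ≠ i + j + k + 1 := by omega
  have hj : j ≠ i + j + k + 1 := by omega
  have hk : k ≠ i + j + k + 1 := by omega
  refine (Dfn.all (Q := fun v a => a ∈ v i ↔ a = v j ∨ a = v k) (i + j + k + 1)
    ((Dfn.mem (i + j + k + 1) i).iff ((Dfn.eq (i + j + k + 1) j).or (Dfn.eq (i + j + k + 1) k)))
    fun v a => ?_).congr fun v => ?_
  · simp [Function.update_of_ne hi, Function.update_of_ne hj, Function.update_of_ne hk]
  · exact ⟨fun h => ext_mem fun m => by rw [h, mem_upair], fun h a => by rw [h, mem_upair]⟩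

theorem Dfn.eqPair (i j k : ℕ) : Dfn fun v : ℕ → M => v i = pair (v j) (v k) := by
  have h : ∀ m, m = i ∨ m = j ∨ m = k → m ≠ i + j + k + 1 ∧ m ≠ i + j + k + 2 := by omega
  refine (Dfn.ex (i + j + k + 1) (Dfn.ex (i + j + k + 2)
    (((Dfn.eqUpair (i + j + k + 1) j j).and (Dfn.eqUpair (i + j + k + 2) j k)).and
      (Dfn.eqUpair i (i + j + k + 1) (i + j + k + 2)))
    (Q := fun v b => (v (i + j + k + 1) = upair (v j) (v j) ∧ b = upair (v j) (v k)) ∧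
      v i = upair (v (i + j + k + 1)) b) fun v a => ?_)
    (Q := fun v a => ∃ b, (a = upair (v j) (v j) ∧ b = upair (v j) (v k)) ∧
      v i = upair a b) fun v a => ?_).congr fun v => ?_
  · simp [Function.update_of_ne (h i (by simp)).2, Function.update_of_ne (h j (by simp)).2,
      Function.update_of_ne (h k (by simp)).2]
  · simp [Function.update_of_ne (h i (by simp)).1, Function.update_of_ne (h j (by simp)).1,
      Function.update_of_ne (h k (by simp)).1]
  · simp [pair]

theorem Dfn.pairMem (j k : ℕ) (c : M) : Dfn fun v : ℕ → M => pair (v j) (v k) ∈ c := by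
  have hj : j ≠ j + k + 1 := by omega
  have hk : k ≠ j + k + 1 := by omega
  refine (Dfn.ex (Q := fun v a => a = pair (v j) (v k) ∧ a ∈ c) (j + k + 1)
    ((Dfn.eqPair (j + k + 1) j k).and (Dfn.memConst (j + k + 1) c)) fun v a => ?_).congr
    fun v => by simp
  simp [Function.update_of_ne hj, Function.update_of_ne hk]

theorem exists_sep {P : M → Prop} (hP : Dfn fun v : ℕ → M => P (v 0)) (a : M) :
    ∃ b : M, ∀ m, m ∈ b ↔ m ∈ a ∧ P m :=
  IsZF.separation P hP.definable₁ a

/-- Separation for a set of pairs given by a binary relation. -/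
theorem exists_sep_pair {P : M → M → Prop} (hP : Dfn fun v : ℕ → M => P (v 1) (v 2)) (a : M) :
    ∃ b : M, ∀ m, m ∈ b ↔ m ∈ a ∧ ∃ c d, m = pair c d ∧ P c d := by
  refine exists_sep (Dfn.ex 1 (Dfn.ex 2 ((Dfn.eqPair 0 1 2).and hP)
    (Q := fun v d => v 0 = pair (v 1) d ∧ P (v 1) d) fun v d => ?_)
    (Q := fun v c => ∃ d, v 0 = pair c d ∧ P c d) fun v c => ?_) a
  · simp [Function.update]
  · simp [Function.update]

end

/-! ### Coded types which are sets of the model -/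

section

variable (M : Type u) [Membership M M]

/-- The members of `α` form a set of the model. -/
class IsSmall (α : Type v) [Coded M α] : Prop where
  univ_internal : IsInternalSet M (Set.univ : Set α)

end

section

variable {M : Type u} [Membership M M] {α : Type v} {β : Type w} {γ : Type x}
  [Coded M α] [Coded M β] [Coded M γ]

theorem code_eq_iff {a b : α} : (Coded.code a : M) = Coded.code b ↔ a = b :=
  Coded.code_injective.eq_iff

theorem exists_code_eq_iff {S : Set α} {a : α} :
    (∃ b ∈ S, (Coded.code b : M) = Coded.code a) ↔ a ∈ S :=
  ⟨fun ⟨_, hb, hab⟩ => Coded.code_injective hab ▸ hb, fun ha => ⟨a, ha, rfl⟩⟩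

theorem IsSmall.exists_code [IsSmall M α] : ∃ s : M, ∀ m, m ∈ s ↔ ∃ a : α, Coded.code a = m := by
  obtain ⟨s, hs⟩ := IsSmall.univ_internal (M := M) (α := α)
  exact ⟨s, fun m => by simp [hs]⟩

instance (a : M) : IsSmall M (Elt a) :=
  ⟨⟨a, fun m => ⟨fun h => ⟨⟨m, h⟩, trivial, rfl⟩, fun ⟨b, _, hb⟩ => hb ▸ b.2⟩⟩⟩

variable [IsZF M]

theorem isInternalSet_of_dfn [IsSmall M α] {S : Set α} {P : M → Prop}
    (hP : Dfn fun v : ℕ → M => P (v 0)) (h : ∀ a, a ∈ S ↔ P (Coded.code a)) :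
    IsInternalSet M S := by
  obtain ⟨s, hs⟩ := IsSmall.exists_code (M := M) (α := α)
  obtain ⟨b, hb⟩ := exists_sep hP s
  refine ⟨b, fun m => ?_⟩
  rw [hb, hs]
  constructor
  · rintro ⟨⟨a, rfl⟩, ha⟩
    exact ⟨a, (h a).2 ha, rfl⟩
  · rintro ⟨a, ha, rfl⟩
    exact ⟨⟨a, rfl⟩, (h a).1 ha⟩

instance [IsSmall M α] [IsSmall M β] : IsSmall M (α × β) := by
  obtain ⟨s, hs⟩ := IsSmall.exists_code (M := M) (α := α)
  obtain ⟨t, ht⟩ := IsSmall.exists_code (M := M) (α := β)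
  obtain ⟨c, hc⟩ := IsZF.union (upair s t)
  obtain ⟨p, hp⟩ := IsZF.powerset c
  obtain ⟨q, hq⟩ := IsZF.powerset p
  -- A Kuratowski pair of elements of s ∪ t is a set of subsets of s ∪ t, so all the pairs lie in
  -- the double power set `q`.
  obtain ⟨b, hb⟩ := exists_sep_pair (P := fun c d => c ∈ s ∧ d ∈ t)
    ((Dfn.memConst 1 s).and (Dfn.memConst 2 t)) q
  refine ⟨⟨b, fun m => ?_⟩⟩
  rw [hb]
  constructor
  · rintro ⟨-, x, y, rfl, hx, hy⟩
    obtain ⟨a, rfl⟩ := (hs x).1 hx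
    obtain ⟨b, rfl⟩ := (ht y).1 hy
    exact ⟨(a, b), trivial, rfl⟩
  · rintro ⟨⟨a, b⟩, -, rfl⟩
    have ha := (hs (Coded.code a)).2 ⟨a, rfl⟩
    have hb := (ht (Coded.code b)).2 ⟨b, rfl⟩
    refine ⟨?_, _, _, rfl, ha, hb⟩
    have hac : Coded.code a ∈ c := (hc _).2 ⟨s, mem_upair.2 (Or.inl rfl), ha⟩
    have hbc : Coded.code b ∈ c := (hc _).2 ⟨t, mem_upair.2 (Or.inr rfl), hb⟩
    refine (hq _).2 fun y hy => (hp _).2 fun z hz => ?_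
    rcases mem_upair.1 hy with rfl | rfl <;> rcases mem_upair.1 hz with rfl | rfl <;> assumption

theorem mem_code_intSet (S : IntSet M α) (m : M) :
    m ∈ (Coded.code S : M) ↔ ∃ a ∈ S, Coded.code a = m :=
  Classical.choose_spec S.2 m

theorem code_mem_code_iff {a : α} {S : IntSet M α} :
    (Coded.code a : M) ∈ (Coded.code S : M) ↔ a ∈ S := by
  rw [mem_code_intSet]
  exact exists_code_eq_iff (S := S.1)

instance [IsSmall M α] : IsSmall M (IntSet M α) := by
  obtain ⟨s, hs⟩ := IsSmall.exists_code (M := M) (α := α)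
  obtain ⟨p, hp⟩ := IsZF.powerset s
  refine ⟨⟨p, fun m => ?_⟩⟩
  rw [hp]
  constructor
  · intro h
    have key : ∀ y, y ∈ m ↔ ∃ a ∈ {a : α | Coded.code a ∈ m}, Coded.code a = y := by
      refine fun y => ⟨fun hy => ?_, ?_⟩
      · obtain ⟨a, rfl⟩ := (hs y).1 (h y hy)
        exact ⟨a, hy, rfl⟩
      · rintro ⟨a, ha, rfl⟩
        exact ha
    exact ⟨⟨{a | Coded.code a ∈ m}, m, key⟩, trivial,
      ext_mem fun y => (mem_code_intSet _ y).trans (key y).symm⟩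
  · rintro ⟨S, -, rfl⟩ y hy
    obtain ⟨a, -, rfl⟩ := (mem_code_intSet S y).1 hy
    exact (hs _).2 ⟨a, rfl⟩

theorem IsSmall.of_code_eq [IsSmall M α] {p : α → Prop} (hp : IsInternalSet M {a | p a})
    (f : β → α) (hf : ∀ b, (Coded.code (f b) : M) = Coded.code b)
    (hfp : ∀ a, p a ↔ ∃ b, f b = a) : IsSmall M β := by
  obtain ⟨s, hs⟩ := hp
  refine ⟨⟨s, fun m => ?_⟩⟩
  rw [hs]
  constructor
  · rintro ⟨a, ha, rfl⟩
    obtain ⟨b, rfl⟩ := (hfp a).1 ha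
    exact ⟨b, trivial, (hf b).symm⟩
  · rintro ⟨b, -, rfl⟩
    exact ⟨f b, (hfp _).2 ⟨b, rfl⟩, hf b⟩

theorem exists_forall_not_mem : ∃ e : M, ∀ m, ¬ m ∈ e := by
  obtain ⟨a, ⟨e, -, he⟩, -⟩ := IsZF.infinity (M := M)
  exact ⟨e, he⟩

open Classical in
/-- Truth values are represented by `∅` and `{∅}`. -/
noncomputable instance : Coded M Prop :=
  ⟨fun p => if p then upair (Classical.choose (exists_forall_not_mem (M := M)))
      (Classical.choose exists_forall_not_mem) else Classical.choose exists_forall_not_mem, by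
    have h := Classical.choose_spec (exists_forall_not_mem (M := M))
    set e := Classical.choose (exists_forall_not_mem (M := M))
    have h1 : ¬ upair e e = e := fun h' => h e ((congrArg (e ∈ ·) h').mp (mem_upair.2 (Or.inl rfl)))
    have h2 : ¬ e = upair e e := fun h' => h1 h'.symm
    intro p q hpq
    by_cases hp : p <;> by_cases hq : q <;> simp_all⟩

instance : IsSmall M Prop :=
  ⟨⟨upair (Coded.code True) (Coded.code False), fun m => by
    rw [mem_upair]
    constructor
    · rintro (rfl | rfl)
      · exact ⟨True, trivial, rfl⟩
      · exact ⟨False, trivial, rfl⟩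
    · rintro ⟨p, -, rfl⟩
      by_cases h : p <;> simp [h]⟩⟩

/-! ### Closure properties of internal functions -/

-- With predicates regarded as functions into the coded type `Prop`, one family of closure rules
-- covers terms and formulas alike, and `fun_prop` can apply it syntactically.
attribute [fun_prop] IsInternalFun

theorem IsInternalSet.exists_code_iff {S : Set α} (hS : IsInternalSet M S) :
    ∃ s : M, ∀ a, Coded.code a ∈ s ↔ a ∈ S := by
  obtain ⟨s, hs⟩ := hS
  exact ⟨s, fun a => by rw [hs]; exact exists_code_eq_iff⟩

theorem IsInternalFun.exists_graph {f : α → β} (hf : IsInternalFun M f) :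
    ∃ s : M, ∀ a b, pair a b ∈ s ↔ ∃ c, a = Coded.code c ∧ b = Coded.code (f c) := by
  obtain ⟨s, hs⟩ := hf
  refine ⟨s, fun a b => ?_⟩
  rw [hs]
  constructor
  · rintro ⟨⟨c, d⟩, hd, h⟩
    obtain rfl : d = f c := hd
    exact ⟨c, (pair_inj h).1.symm, (pair_inj h).2.symm⟩
  · rintro ⟨c, rfl, rfl⟩
    exact ⟨(c, f c), rfl, rfl⟩

theorem isInternalSet_of_dfn_pair [IsSmall M α] [IsSmall M β] {S : Set (α × β)} {P : M → M → Prop}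
    (hP : Dfn fun v : ℕ → M => P (v 1) (v 2))
    (h : ∀ a b, (a, b) ∈ S ↔ P (Coded.code a) (Coded.code b)) : IsInternalSet M S := by
  obtain ⟨s, hs⟩ := IsSmall.exists_code (M := M) (α := α × β)
  obtain ⟨b, hb⟩ := exists_sep_pair hP s
  refine ⟨b, fun m => ?_⟩
  rw [hb, hs]
  constructor
  · rintro ⟨⟨⟨a, b⟩, rfl⟩, x, y, hxy, hP⟩
    obtain ⟨rfl, rfl⟩ := pair_inj hxy
    exact ⟨(a, b), (h a b).2 hP, rfl⟩
  · rintro ⟨⟨a, b⟩, hab, rfl⟩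
    exact ⟨⟨(a, b), rfl⟩, _, _, rfl, (h a b).1 hab⟩

theorem isInternalFun_of_dfn [IsSmall M α] [IsSmall M β] {f : α → β} {P : M → M → Prop}
    (hP : Dfn fun v : ℕ → M => P (v 1) (v 2))
    (h : ∀ a b, b = f a ↔ P (Coded.code a) (Coded.code b)) : IsInternalFun M f :=
  isInternalSet_of_dfn_pair hP h

theorem isInternalFun_of_code_eq [IsSmall M α] [IsSmall M β] {f : α → β}
    (hf : ∀ a, (Coded.code (f a) : M) = Coded.code a) : IsInternalFun M f :=
  isInternalFun_of_dfn (P := fun x y => y = x) (Dfn.eq 2 1) fun a b => by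
    rw [← hf, code_eq_iff]

@[fun_prop]
theorem IsInternalFun.id [IsSmall M α] : IsInternalFun M fun a : α => a :=
  isInternalFun_of_code_eq fun _ => rfl

@[fun_prop]
theorem IsInternalFun.const [IsSmall M α] [IsSmall M β] (b : β) :
    IsInternalFun M fun _ : α => b :=
  isInternalFun_of_dfn (P := fun _ y => y = Coded.code b) (Dfn.eqConst 2 _) fun a c =>
    code_eq_iff.symm

-- The intermediate value is quantified over all of `M`, so the middle type need not be a set of the
-- model.
@[fun_prop]
theorem IsInternalFun.comp [IsSmall M α] [IsSmall M γ] {f : β → γ} {g : α → β}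
    (hf : IsInternalFun M f) (hg : IsInternalFun M g) : IsInternalFun M fun a => f (g a) := by
  obtain ⟨s, hs⟩ := hf.exists_graph
  obtain ⟨t, ht⟩ := hg.exists_graph
  refine isInternalFun_of_dfn (P := fun x y => ∃ z, pair x z ∈ t ∧ pair z y ∈ s)
    (Dfn.ex 3 ((Dfn.pairMem 1 3 t).and (Dfn.pairMem 3 2 s)) fun v a => by simp [Function.update])
    fun a c => ⟨?_, ?_⟩
  · rintro rfl
    exact ⟨Coded.code (g a), (ht _ _).2 ⟨a, rfl, rfl⟩, (hs _ _).2 ⟨g a, rfl, rfl⟩⟩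
  · rintro ⟨z, h1, h2⟩
    obtain ⟨b, hb, rfl⟩ := (ht _ _).1 h1
    obtain ⟨b', hb', h'⟩ := (hs _ _).1 h2
    rw [code_eq_iff] at hb hb' h'
    rw [h', ← hb', hb]

/-- Passage between separation, which produces sets, and the calculus of internal functions: a set
corresponds to its characteristic function. -/
theorem isInternalFun_prop_iff [IsSmall M α] {P : α → Prop} :
    IsInternalFun M P ↔ IsInternalSet M {a | P a} := by
  constructor
  · intro h
    obtain ⟨s, hs⟩ := h.exists_graph
    obtain ⟨t, ht⟩ : ∃ t : M, t = Coded.code True := ⟨_, rfl⟩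
    refine isInternalSet_of_dfn (P := fun m => ∃ y, y = t ∧ pair m y ∈ s)
      (Dfn.ex 1 ((Dfn.eqConst 1 t).and (Dfn.pairMem 0 1 s)) fun v a => by simp [Function.update])
      fun a => ?_
    simp only [ht, exists_eq_left, hs, code_eq_iff]
    simp
  · intro h
    obtain ⟨s, hs⟩ := h.exists_code_iff
    refine isInternalFun_of_dfn
      (P := fun x y => (x ∈ s ∧ y = Coded.code True) ∨ (¬ x ∈ s ∧ y = Coded.code False))
      (((Dfn.memConst 1 s).and (Dfn.eqConst 2 _)).or
        ((Dfn.memConst 1 s).not.and (Dfn.eqConst 2 _))) fun a p => ?_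
    rw [hs, code_eq_iff, code_eq_iff, Set.mem_ofPred_eq]
    by_cases h1 : P a <;> by_cases h2 : p <;> simp [h1, h2]

theorem IsInternalFun.isInternalSet [IsSmall M α] {P : α → Prop} (h : IsInternalFun M P) :
    IsInternalSet M {a | P a} := isInternalFun_prop_iff.1 h

/-- The tool for functions obtained by definite description: values picked outside the model are
harmless once a formula determines them. -/
theorem IsInternalFun.of_graph [IsSmall M α] [IsSmall M β] {f : α → β} {P : α → β → Prop}
    (hP : IsInternalFun M fun p : α × β => P p.1 p.2) (h : ∀ a b, P a b ↔ b = f a) :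
    IsInternalFun M f := by
  have := hP.isInternalSet
  simp only [h] at this
  exact this

@[fun_prop]
theorem IsInternalFun.fst [IsSmall M α] [IsSmall M β] [IsSmall M γ] {f : α → β × γ}
    (hf : IsInternalFun M f) : IsInternalFun M fun a => (f a).1 := by
  refine IsInternalFun.comp (f := Prod.fst) (isInternalFun_of_dfn (P := fun x y => ∃ z, x = pair y z)
    (Dfn.ex 3 (Dfn.eqPair 1 2 3) fun v a => by simp [Function.update]) fun a c => ⟨?_, ?_⟩) hf
  · rintro rfl
    exact ⟨_, rfl⟩
  · rintro ⟨z, hz⟩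
    exact (code_eq_iff.1 (pair_inj hz).1).symm

@[fun_prop]
theorem IsInternalFun.snd [IsSmall M α] [IsSmall M β] [IsSmall M γ] {f : α → β × γ}
    (hf : IsInternalFun M f) : IsInternalFun M fun a => (f a).2 := by
  refine IsInternalFun.comp (f := Prod.snd) (isInternalFun_of_dfn (P := fun x y => ∃ z, x = pair z y)
    (Dfn.ex 3 (Dfn.eqPair 1 3 2) fun v a => by simp [Function.update]) fun a c => ⟨?_, ?_⟩) hf
  · rintro rfl
    exact ⟨_, rfl⟩
  · rintro ⟨z, hz⟩
    exact (code_eq_iff.1 (pair_inj hz).2).symm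

@[fun_prop]
theorem IsInternalFun.prodMk [IsSmall M α] [IsSmall M β] [IsSmall M γ] {f : α → β} {g : α → γ}
    (hf : IsInternalFun M f) (hg : IsInternalFun M g) : IsInternalFun M fun a => (f a, g a) := by
  obtain ⟨s, hs⟩ := hf.exists_graph
  obtain ⟨t, ht⟩ := hg.exists_graph
  refine isInternalFun_of_dfn
    (P := fun x y => ∃ b, ∃ c, y = pair b c ∧ pair x b ∈ s ∧ pair x c ∈ t)
    (Dfn.ex 3 (Dfn.ex 4 (Q := fun v c => v 2 = pair (v 3) c ∧ pair (v 1) (v 3) ∈ s ∧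
        pair (v 1) c ∈ t)
      ((Dfn.eqPair 2 3 4).and ((Dfn.pairMem 1 3 s).and (Dfn.pairMem 1 4 t)))
      fun v a => by simp [Function.update]) fun v a => by simp [Function.update])
    fun a p => ⟨?_, ?_⟩
  · rintro rfl
    exact ⟨_, _, rfl, (hs _ _).2 ⟨a, rfl, rfl⟩, (ht _ _).2 ⟨a, rfl, rfl⟩⟩
  · rintro ⟨b, c, hp, h1, h2⟩
    obtain ⟨a1, ha1, rfl⟩ := (hs _ _).1 h1
    obtain ⟨a2, ha2, rfl⟩ := (ht _ _).1 h2
    rw [code_eq_iff] at ha1 ha2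
    subst ha1 ha2
    exact Prod.ext (code_eq_iff.1 (pair_inj hp).1) (code_eq_iff.1 (pair_inj hp).2)

@[fun_prop]
theorem IsInternalFun.not [IsSmall M α] {P : α → Prop} (hP : IsInternalFun M P) :
    IsInternalFun M fun a => ¬ P a := by
  rw [isInternalFun_prop_iff] at hP ⊢
  obtain ⟨s, hs⟩ := hP.exists_code_iff
  exact isInternalSet_of_dfn (P := fun m => ¬ m ∈ s) (Dfn.memConst 0 s).not fun a => by
    rw [hs]; rfl

@[fun_prop]
theorem IsInternalFun.and [IsSmall M α] {P Q : α → Prop} (hP : IsInternalFun M P)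
    (hQ : IsInternalFun M Q) : IsInternalFun M fun a => P a ∧ Q a := by
  rw [isInternalFun_prop_iff] at hP hQ ⊢
  obtain ⟨s, hs⟩ := hP.exists_code_iff
  obtain ⟨t, ht⟩ := hQ.exists_code_iff
  exact isInternalSet_of_dfn (P := fun m => m ∈ s ∧ m ∈ t)
    ((Dfn.memConst 0 s).and (Dfn.memConst 0 t)) fun a => by rw [hs, ht]; rfl

theorem IsInternalFun.congr_prop {P Q : α → Prop} (hP : IsInternalFun M P)
    (h : ∀ a, P a ↔ Q a) : IsInternalFun M Q := by
  have : P = Q := funext fun a => propext (h a)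
  exact this ▸ hP

@[fun_prop]
theorem IsInternalFun.or [IsSmall M α] {P Q : α → Prop} (hP : IsInternalFun M P)
    (hQ : IsInternalFun M Q) : IsInternalFun M fun a => P a ∨ Q a :=
  ((hP.not.and hQ.not).not).congr_prop fun a => by tauto

@[fun_prop]
theorem IsInternalFun.imp [IsSmall M α] {P Q : α → Prop} (hP : IsInternalFun M P)
    (hQ : IsInternalFun M Q) : IsInternalFun M fun a => P a → Q a :=
  ((hP.and hQ.not).not).congr_prop fun a => by tauto

@[fun_prop]
theorem IsInternalFun.iff [IsSmall M α] {P Q : α → Prop} (hP : IsInternalFun M P)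
    (hQ : IsInternalFun M Q) : IsInternalFun M fun a => P a ↔ Q a :=
  ((hP.imp hQ).and (hQ.imp hP)).congr_prop fun a => by tauto

@[fun_prop]
theorem IsInternalFun.exists [IsSmall M α] [IsSmall M β] {P : α → β → Prop}
    (hP : IsInternalFun M fun p : α × β => P p.1 p.2) : IsInternalFun M fun a => ∃ b, P a b := by
  rw [isInternalFun_prop_iff] at hP ⊢
  obtain ⟨s, hs⟩ := hP
  refine isInternalSet_of_dfn (P := fun m => ∃ y, pair m y ∈ s)
    (Dfn.ex 1 (Dfn.pairMem 0 1 s) fun v a => by simp [Function.update]) fun a => ⟨?_, ?_⟩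
  · rintro ⟨b, hb⟩
    exact ⟨Coded.code b, (hs _).2 ⟨(a, b), hb, rfl⟩⟩
  · rintro ⟨y, hy⟩
    obtain ⟨⟨a', b⟩, hb, h⟩ := (hs _).1 hy
    have ha := code_eq_iff.1 (pair_inj h).1
    subst ha
    exact ⟨b, hb⟩

@[fun_prop]
theorem IsInternalFun.forall [IsSmall M α] [IsSmall M β] {P : α → β → Prop}
    (hP : IsInternalFun M fun p : α × β => P p.1 p.2) : IsInternalFun M fun a => ∀ b, P a b :=
  (IsInternalFun.exists (P := fun a b => ¬ P a b) hP.not).not.congr_prop fun a => by simp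

@[fun_prop]
theorem IsInternalFun.eq [IsSmall M α] [IsSmall M β] {f g : α → β} (hf : IsInternalFun M f)
    (hg : IsInternalFun M g) : IsInternalFun M fun a => f a = g a := by
  have h : IsInternalFun M fun p : β × β => p.1 = p.2 := isInternalFun_prop_iff.2 <|
    isInternalSet_of_dfn_pair (P := fun x y => x = y) (Dfn.eq 1 2) fun a b => by
      rw [code_eq_iff]; rfl
  exact h.comp (hf.prodMk hg)

@[fun_prop]
theorem IsInternalFun.mem [IsSmall M α] [IsSmall M β] {f : α → β} {g : α → IntSet M β}
    (hf : IsInternalFun M f) (hg : IsInternalFun M g) : IsInternalFun M fun a => f a ∈ g a := by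
  have h : IsInternalFun M fun p : β × IntSet M β => p.1 ∈ p.2 := isInternalFun_prop_iff.2 <|
    isInternalSet_of_dfn_pair (P := fun x y => x ∈ y) (Dfn.mem 1 2) fun a b => by
      rw [code_mem_code_iff]; rfl
  exact h.comp (hf.prodMk hg)

/-! ### Sets and functions of the model as values of internal functions -/

theorem IntSet.ext {S T : IntSet M α} (h : ∀ a, a ∈ S ↔ a ∈ T) : S = T :=
  Subtype.ext (Set.ext h)

theorem IntFun.ext {f g : IntFun M α β} (h : ∀ a, f a = g a) : f = g :=
  Subtype.ext (funext h)

/-- Currying for families of sets: by extensionality, the value at `a` is pinned down by the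
membership relation. -/
theorem isInternalFun_intSet [IsSmall M α] [IsSmall M β] {f : α → IntSet M β}
    (h : IsInternalFun M fun p : α × β => p.2 ∈ f p.1) : IsInternalFun M f :=
  IsInternalFun.of_graph (P := fun a S => ∀ b, b ∈ S ↔ b ∈ f a)
    (by
      have h' : IsInternalFun M fun p : (α × IntSet M β) × β => p.2 ∈ f p.1.1 :=
        h.comp (g := fun p : (α × IntSet M β) × β => (p.1.1, p.2)) (by fun_prop)
      fun_prop) fun a S => ⟨IntSet.ext, fun h b => by rw [h]⟩

/-- The set of the members of `α` satisfying an internal predicate. -/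
def IntSet.mk [IsSmall M α] (P : α → Prop) (hP : IsInternalFun M P) : IntSet M α :=
  ⟨{a | P a}, hP.isInternalSet⟩

@[simp]
theorem IntSet.mem_mk [IsSmall M α] {P : α → Prop} {hP : IsInternalFun M P} {a : α} :
    a ∈ IntSet.mk P hP ↔ P a := Iff.rfl

/-- The graph of a function of the model. -/
def IntFun.graph (f : IntFun M α β) : IntSet M (α × β) := ⟨{p : α × β | p.2 = f p.1}, f.2⟩

theorem IntFun.code_graph (f : IntFun M α β) : (Coded.code f.graph : M) = Coded.code f := rfl

/-- Functions are coded by their graphs, so they are separated from the power set of the product by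
functionality, a first-order condition. -/
instance [IsSmall M α] [IsSmall M β] : IsSmall M (IntFun M α β) := by
  refine IsSmall.of_code_eq (α := IntSet M (α × β))
    (p := fun G => ∀ a, ∃ b, ∀ c, (a, c) ∈ G ↔ c = b)
    (IsInternalFun.isInternalSet (by fun_prop)) IntFun.graph IntFun.code_graph fun G => ⟨?_, ?_⟩
  · intro h
    choose f hf using h
    have : G.1 = {p : α × β | p.2 = f p.1} := Set.ext fun p => hf p.1 p.2
    exact ⟨⟨f, (congrArg (IsInternalSet M) this).mp G.2⟩, Subtype.ext this.symm⟩
  · rintro ⟨f, rfl⟩ a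
    exact ⟨f a, fun c => Iff.rfl⟩

@[fun_prop]
theorem IsInternalFun.app [IsSmall M α] [IsSmall M β] [IsSmall M γ] {f : α → IntFun M β γ}
    {g : α → β} (hf : IsInternalFun M f) (hg : IsInternalFun M g) :
    IsInternalFun M fun a => (f a).1 (g a) := by
  have h0 : IsInternalFun M (IntFun.graph : IntFun M β γ → IntSet M (β × γ)) :=
    isInternalFun_of_code_eq IntFun.code_graph
  have h : IsInternalFun M fun p : IntFun M β γ × β => p.1.1 p.2 :=
    IsInternalFun.of_graph (P := fun p c => (p.2, c) ∈ p.1.graph) (by fun_prop) fun p c => Iff.rfl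
  exact h.comp (hf.prodMk hg)

theorem isInternalFun_intFun [IsSmall M α] [IsSmall M β] [IsSmall M γ] {f : α → IntFun M β γ}
    (h : IsInternalFun M fun p : α × β => (f p.1).1 p.2) : IsInternalFun M f :=
  IsInternalFun.of_graph (P := fun a S => ∀ b, S.1 b = (f a).1 b)
    (by
      have h' : IsInternalFun M fun p : (α × IntFun M β γ) × β => (f p.1.1).1 p.2 :=
        h.comp (g := fun p : (α × IntFun M β γ) × β => (p.1.1, p.2)) (by fun_prop)
      fun_prop) fun a S => ⟨IntFun.ext, fun h b => by rw [h]⟩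

/-- Not an instance, because it depends on a proof that the predicate is internal; each subtype in
use gets its own instance. -/
theorem IsSmall.subtype [IsSmall M α] {p : α → Prop} (hp : IsInternalFun M p) :
    IsSmall M {a // p a} :=
  IsSmall.of_code_eq hp.isInternalSet Subtype.val (fun _ => rfl) fun a => by simp

@[fun_prop]
theorem IsInternalFun.val [IsSmall M α] [IsSmall M β] {p : β → Prop} [IsSmall M {b // p b}]
    {f : α → {b // p b}} (hf : IsInternalFun M f) : IsInternalFun M fun a => (f a).1 :=
  (isInternalFun_of_code_eq fun _ => rfl : IsInternalFun M (Subtype.val : {b // p b} → β)).comp hf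

theorem IsInternalFun.of_val [IsSmall M α] [IsSmall M β] {p : β → Prop} [IsSmall M {b // p b}]
    {f : α → {b // p b}} (hf : IsInternalFun M fun a => (f a).1) : IsInternalFun M f :=
  IsInternalFun.of_graph (P := fun a b => b.1 = (f a).1)
    (by
      have h' : IsInternalFun M fun q : α × {b // p b} => (f q.1).1 :=
        hf.comp (g := fun q : α × {b // p b} => q.1) (by fun_prop)
      fun_prop) fun _ _ => Subtype.ext_iff.symm

open Classical in
@[fun_prop]
theorem IsInternalFun.ite [IsSmall M α] [IsSmall M β] {P : α → Prop} {f g : α → β}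
    (hP : IsInternalFun M P) (hf : IsInternalFun M f) (hg : IsInternalFun M g) :
    IsInternalFun M fun a => if P a then f a else g a :=
  IsInternalFun.of_graph (P := fun a b => (P a ∧ b = f a) ∨ (¬ P a ∧ b = g a)) (by fun_prop)
    fun a b => by by_cases h : P a <;> simp [h]

end

section

variable {M : Type u} [Membership M M] [IsZF M] {α : Type v} {β : Type w} {γ : Type x}
  [Coded M α] [Coded M β] [Coded M γ]

/-! ### Natural numbers of the model -/

-- The definition of a natural number quantifies over all sets of the model. Inside an inductive set
-- `I` it suffices to test the subsets of `I`, since intersecting an arbitrary inductive set with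
-- `I` changes nothing there; this makes the condition one over coded types.
variable (M) in
theorem exists_omega : ∃ s : M, ∀ n, n ∈ s ↔ IsNat n := by
  obtain ⟨I, ⟨e, heI, he⟩, hI⟩ := IsZF.infinity (M := M)
  have hsucc : IsInternalFun M fun p : Elt I × Elt I => ∀ x, x ∈ p.2.1 ↔ x ∈ p.1.1 ∨ x = p.1.1 :=
    isInternalFun_prop_iff.2 <| isInternalSet_of_dfn_pair
      (P := fun k s => ∀ x, x ∈ s ↔ x ∈ k ∨ x = k)
      (Dfn.all 3 ((Dfn.mem 3 2).iff ((Dfn.mem 3 1).or (Dfn.eq 3 1)))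
        fun v a => by simp [Function.update]) fun a b => Iff.rfl
  obtain ⟨z, rfl⟩ : ∃ z : Elt I, z.1 = e := ⟨⟨e, heI⟩, rfl⟩
  have key : IsInternalFun M fun n : Elt I => ∀ S : IntSet M (Elt I), z ∈ S →
      (∀ k s : Elt I, k ∈ S → (∀ x, x ∈ s.1 ↔ x ∈ k.1 ∨ x = k.1) → s ∈ S) → n ∈ S := by
    have h2 : IsInternalFun M fun q : ((Elt I × IntSet M (Elt I)) × Elt I) × Elt I =>
        ∀ x, x ∈ q.2.1 ↔ x ∈ q.1.2.1 ∨ x = q.1.2.1 :=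
      hsucc.comp (g := fun q : ((Elt I × IntSet M (Elt I)) × Elt I) × Elt I => (q.1.2, q.2))
        (by fun_prop)
    have h3 : IsInternalFun M fun q : ((Elt I × IntSet M (Elt I)) × Elt I) × Elt I =>
        (q.1.2 ∈ q.1.1.2 → (∀ x, x ∈ q.2.1 ↔ x ∈ q.1.2.1 ∨ x = q.1.2.1) → q.2 ∈ q.1.1.2) :=
      IsInternalFun.imp (by fun_prop) (IsInternalFun.imp h2 (by fun_prop))
    refine IsInternalFun.forall (IsInternalFun.imp (by fun_prop) (IsInternalFun.imp ?_ ?_))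
    · exact IsInternalFun.forall (IsInternalFun.forall h3)
    · fun_prop
  obtain ⟨s, hs⟩ := key.isInternalSet
  refine ⟨s, fun n => ?_⟩
  rw [hs]
  constructor
  · rintro ⟨m, hm, rfl⟩ a ha0 hasucc
    have hint : IsInternalFun M fun k : Elt I => k.1 ∈ a := isInternalFun_prop_iff.2 <|
      isInternalSet_of_dfn (P := fun k => k ∈ a) (Dfn.memConst 0 a) fun _ => Iff.rfl
    exact hm (IntSet.mk _ hint) (ha0 z.1 he) fun k s hk hs => hasucc k.1 hk s.1 hs
  · intro hn
    have hnI : n ∈ I := by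
      refine hn I (fun e' he' => ?_) fun k hk s hs => ?_
      · rwa [show e' = z.1 from ext_mem fun m => iff_of_false (he' m) (he m)]
      · obtain ⟨s', hs'I, hs'⟩ := hI k hk
        rwa [show s = s' from ext_mem fun m => (hs m).trans (hs' m).symm]
    refine ⟨⟨n, hnI⟩, fun S h0 hS => ?_, rfl⟩
    obtain ⟨t, ht⟩ := S.2
    obtain ⟨m, hm, rfl⟩ := (ht n).1 <| hn t (fun e' he' => (ht _).2 ⟨z, h0,
      ext_mem fun m => iff_of_false (he m) (he' m)⟩) fun k hk s hs => by
        obtain ⟨k', hk', rfl⟩ := (ht k).1 hk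
        obtain ⟨s', hs'I, hs'⟩ := hI k'.1 k'.2
        exact (ht s).2 ⟨⟨s', hs'I⟩, hS k' _ hk' hs', ext_mem fun m => (hs' m).trans (hs m).symm⟩
    exact hm

variable (M) in
/-- The set of natural numbers of the model. -/
noncomputable def omega : M := Classical.choose (exists_omega M)

theorem mem_omega {n : M} : n ∈ omega M ↔ IsNat n := Classical.choose_spec (exists_omega M) n

theorem omega_induction {P : Elt (omega M) → Prop} (hP : IsInternalFun M P)
    (zero : ∀ e, (∀ x, ¬ x ∈ e.1) → P e)
    (succ : ∀ k s : Elt (omega M), (∀ x, x ∈ s.1 ↔ x ∈ k.1 ∨ x = k.1) → P k → P s)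
    (n : Elt (omega M)) : P n := by
  obtain ⟨t, ht⟩ := hP.isInternalSet
  have h0 : ∀ e : M, (∀ x, ¬ x ∈ e) → IsNat e := fun e he a h _ => h e he
  have hs : ∀ k s : M, IsNat k → (∀ x, x ∈ s ↔ x ∈ k ∨ x = k) → IsNat s :=
    fun k s hk hs a h1 h2 => h2 k (hk a h1 h2) s hs
  obtain ⟨m, hm, hmn⟩ := (ht n.1).1 <| mem_omega.1 n.2 t
    (fun e he => (ht _).2 ⟨⟨e, mem_omega.2 (h0 e he)⟩, zero _ he, rfl⟩) fun k hk s hks => by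
      obtain ⟨k', hk', rfl⟩ := (ht k).1 hk
      exact (ht s).2 ⟨⟨s, mem_omega.2 (hs _ s (mem_omega.1 k'.2) hks)⟩, succ k' _ hks hk', rfl⟩
  rwa [← Subtype.ext (a1 := m) (a2 := n) hmn]

theorem exists_succ (k : M) : ∃ s : M, ∀ x, x ∈ s ↔ x ∈ k ∨ x = k := by
  obtain ⟨s, hs⟩ := IsZF.union (upair k (upair k k))
  refine ⟨s, fun x => ?_⟩
  rw [hs]
  simp [mem_upair]

/-- Ensures that k is a new element of k ∪ {k}, so that a bijection from k extends by one point. -/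
theorem not_mem_self (k : M) : ¬ k ∈ k := by
  intro hk
  obtain ⟨x, hx, h⟩ := IsZF.foundation (upair k k) ⟨k, mem_upair.2 (Or.inl rfl)⟩
  obtain rfl : x = k := (mem_upair.1 hx).elim (fun h => h) fun h => h
  exact h x hk hx

theorem isInternalFun_elt_mem (a b : M) :
    IsInternalFun M fun p : Elt a × Elt b => p.1.1 ∈ p.2.1 :=
  isInternalFun_prop_iff.2 <| isInternalSet_of_dfn_pair (P := fun x y => x ∈ y) (Dfn.mem 1 2)
    fun _ _ => Iff.rfl

/-- Allows each natural number to be treated as a subset of the single type `Elt (omega M)`. -/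
theorem omega_trans (n : Elt (omega M)) : ∀ x, x ∈ n.1 → x ∈ omega M := by
  have h : IsInternalFun M fun n : Elt (omega M) => ∀ x, x ∈ n.1 → x ∈ omega M :=
    isInternalFun_prop_iff.2 <| isInternalSet_of_dfn (P := fun n => ∀ x, x ∈ n → x ∈ omega M)
      (Dfn.all 1 (((Dfn.mem 1 0).and (Dfn.memConst 1 (omega M)).not).not)
        fun v a => by simp [Function.update]) fun _ => Iff.rfl
  refine omega_induction h (fun e he x hx => absurd hx (he x)) (fun k s hs ih x hx => ?_) n
  rcases (hs x).1 hx with hx | rfl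
  · exact ih x hx
  · exact k.2

/-! ### Equipotence and finite sets -/

/-- `G` is the graph of a bijection from `S` to `T`. -/
structure IsBijRel (G : α → β → Prop) (S : α → Prop) (T : β → Prop) : Prop where
  mem : ∀ a b, G a b → S a ∧ T b
  left : ∀ a, S a → ∃ b, G a b
  right : ∀ b, T b → ∃ a, G a b
  unique : ∀ a b c, G a b → G a c → b = c
  inj : ∀ a b c, G a c → G b c → a = b

theorem isBijRel_iff {G : α → β → Prop} {S : α → Prop} {T : β → Prop} :
    IsBijRel G S T ↔ (∀ a b, G a b → S a ∧ T b) ∧ (∀ a, S a → ∃ b, G a b) ∧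
      (∀ b, T b → ∃ a, G a b) ∧ (∀ a b c, G a b → G a c → b = c) ∧
      (∀ a b c, G a c → G b c → a = b) :=
  ⟨fun h => ⟨h.1, h.2, h.3, h.4, h.5⟩, fun h => ⟨h.1, h.2.1, h.2.2.1, h.2.2.2.1, h.2.2.2.2⟩⟩

theorem IsBijRel.exists_fun {S : Set α} {T : Set β} {G : IntSet M (α × β)}
    (hG : IsBijRel (fun a b => (a, b) ∈ G) (· ∈ S) (· ∈ T)) :
    ∃ f : S → T, IsInternalFun M f ∧ Function.Bijective f ∧ ∀ a, (a.1, (f a).1) ∈ G := by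
  choose f hf using hG.left
  obtain ⟨s, hs⟩ := G.2
  refine ⟨fun a => ⟨f a.1 a.2, (hG.mem _ _ (hf a.1 a.2)).2⟩, ⟨s, fun m => ?_⟩, ⟨?_, ?_⟩, fun a => hf a.1 a.2⟩
  · rw [hs]
    constructor
    · rintro ⟨⟨a, b⟩, hab, rfl⟩
      obtain ⟨ha, hb⟩ := hG.mem a b hab
      exact ⟨(⟨a, ha⟩, ⟨b, hb⟩), Subtype.ext (hG.unique _ _ _ hab (hf a ha)), rfl⟩
    · rintro ⟨⟨a, b⟩, hab, rfl⟩
      exact ⟨(a.1, f a.1 a.2), hf _ _, congrArg Coded.code (Prod.ext rfl hab.symm :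
        ((a, ⟨f a.1 a.2, (hG.mem _ _ (hf a.1 a.2)).2⟩) : S × T) = (a, b))⟩
  · intro a b hab
    have h1 := hf a.1 a.2
    have h2 : f a.1 a.2 = f b.1 b.2 := congrArg Subtype.val hab
    rw [h2] at h1
    exact Subtype.ext (hG.inj _ _ _ h1 (hf b.1 b.2))
  · intro b
    obtain ⟨a, ha⟩ := hG.right b.1 b.2
    have haS := (hG.mem _ _ ha).1
    exact ⟨⟨a, haS⟩, Subtype.ext (hG.unique _ _ _ (hf a haS) ha)⟩

/-- Functions between varying subtypes cannot be quantified over uniformly; their graphs are subsets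
of the fixed product `α × β`. -/
theorem equipotent_iff {S : Set α} {T : Set β} :
    Equipotent M S T ↔ ∃ G : IntSet M (α × β), IsBijRel (fun a b => (a, b) ∈ G) (· ∈ S) (· ∈ T) := by
  constructor
  · rintro ⟨f, ⟨s, hs⟩, hf⟩
    have key : ∀ a b, (∃ h : a ∈ S, (f ⟨a, h⟩).1 = b) ↔ Coded.code (a, b) ∈ s := by
      intro a b
      rw [hs]
      constructor
      · rintro ⟨h, rfl⟩
        exact ⟨(⟨a, h⟩, f ⟨a, h⟩), rfl, rfl⟩
      · rintro ⟨⟨a', b'⟩, h, h'⟩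
        obtain rfl : b' = f a' := h
        obtain ⟨h1, h2⟩ := pair_inj h'
        obtain rfl : a'.1 = a := Coded.code_injective h1
        exact ⟨a'.2, Coded.code_injective h2⟩
    refine ⟨⟨{p | ∃ h : p.1 ∈ S, (f ⟨p.1, h⟩).1 = p.2}, s, fun m => ?_⟩, ?_, ?_, ?_, ?_, ?_⟩
    · constructor
      · intro hm
        obtain ⟨⟨a', b'⟩, h, rfl⟩ := (hs m).1 hm
        obtain rfl : b' = f a' := h
        exact ⟨(a'.1, (f a').1), ⟨a'.2, rfl⟩, rfl⟩
      · rintro ⟨⟨a, b⟩, h, rfl⟩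
        exact (key a b).1 h
    · rintro a b ⟨h, h'⟩
      have h2 : (f ⟨a, h⟩).1 = b := h'
      exact ⟨h, h2 ▸ (f _).2⟩
    · exact fun a ha => ⟨(f ⟨a, ha⟩).1, ha, rfl⟩
    · intro b hb
      obtain ⟨a, ha⟩ := hf.2 ⟨b, hb⟩
      exact ⟨a.1, a.2, congrArg Subtype.val ha⟩
    · rintro a b c ⟨h, h1⟩ ⟨h', h2⟩
      exact h1.symm.trans h2
    · rintro a b c ⟨h, h1⟩ ⟨h', h2⟩
      exact (congrArg Subtype.val (hf.1 (Subtype.ext (h1.trans h2.symm))) :)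
  · rintro ⟨G, hG⟩
    obtain ⟨f, hf, hf', -⟩ := hG.exists_fun
    exact ⟨f, hf, hf'⟩

/-- Replaces the type `Elt n`, which depends on `n`, by the fixed type `Elt (omega M)`, so that
finiteness becomes an internal predicate. -/
theorem isFinite_iff {S : Set α} :
    IsFinite M S ↔ ∃ n : Elt (omega M), ∃ G : IntSet M (Elt (omega M) × α),
      IsBijRel (fun k a => (k, a) ∈ G) (fun k => k.1 ∈ n.1) (· ∈ S) := by
  simp only [IsFinite, equipotent_iff]
  constructor
  · rintro ⟨n, hn, G, hG⟩
    have hnω := omega_trans ⟨n, mem_omega.2 hn⟩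
    obtain ⟨s, hs⟩ := G.2
    refine ⟨⟨n, mem_omega.2 hn⟩, ⟨{p | ∃ h : p.1.1 ∈ n, ((⟨p.1.1, h⟩ : Elt n), p.2) ∈ G}, s,
      fun m => ?_⟩, ?_, ?_, ?_, ?_, ?_⟩
    · rw [hs]
      constructor
      · rintro ⟨⟨k, a⟩, h, rfl⟩
        exact ⟨(⟨k.1, hnω k.1 k.2⟩, a), ⟨k.2, h⟩, rfl⟩
      · rintro ⟨⟨k, a⟩, ⟨h, h'⟩, rfl⟩
        exact ⟨(⟨k.1, h⟩, a), h', rfl⟩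
    · rintro k a ⟨h, h'⟩
      exact ⟨h, (hG.mem _ _ h').2⟩
    · intro k hk
      obtain ⟨a, ha⟩ := hG.left ⟨k.1, hk⟩ trivial
      exact ⟨a, hk, ha⟩
    · intro a ha
      obtain ⟨k, hk⟩ := hG.right a ha
      exact ⟨⟨k.1, hnω _ k.2⟩, k.2, hk⟩
    · rintro a b c ⟨h, h1⟩ ⟨h', h2⟩
      exact hG.unique _ _ _ h1 h2
    · rintro a b c ⟨h, h1⟩ ⟨h', h2⟩
      exact Subtype.ext (congrArg Subtype.val (hG.inj _ _ _ h1 h2) :)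
  · rintro ⟨n, G, hG⟩
    obtain ⟨s, hs⟩ := G.2
    have hω := omega_trans n
    refine ⟨n.1, mem_omega.1 n.2, ⟨{p | ((⟨p.1.1, hω _ p.1.2⟩ : Elt (omega M)), p.2) ∈ G}, s,
      fun m => ?_⟩, ?_, ?_, ?_, ?_, ?_⟩
    · rw [hs]
      constructor
      · rintro ⟨⟨k, a⟩, h, rfl⟩
        exact ⟨(⟨k.1, (hG.mem _ _ h).1⟩, a), h, rfl⟩
      · rintro ⟨⟨k, a⟩, h, rfl⟩
        exact ⟨(⟨k.1, hω _ k.2⟩, a), h, rfl⟩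
    · exact fun k a h => ⟨trivial, (hG.mem _ _ h).2⟩
    · exact fun k _ => hG.left ⟨k.1, hω _ k.2⟩ k.2
    · intro a ha
      obtain ⟨k, hk⟩ := hG.right a ha
      exact ⟨⟨k.1, (hG.mem _ _ hk).1⟩, hk⟩
    · exact fun a b c h1 h2 => hG.unique _ _ _ h1 h2
    · exact fun a b c h1 h2 => Subtype.ext (congrArg Subtype.val (hG.inj _ _ _ h1 h2) :)

@[fun_prop]
theorem IsInternalFun.isFinite [IsSmall M α] [IsSmall M β] {f : α → IntSet M β}
    (hf : IsInternalFun M f) : IsInternalFun M fun a => IsFinite M (f a).1 := by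
  have h : IsInternalFun M fun S : IntSet M β => IsFinite M S.1 := by
    have h0 : IsInternalFun M fun q : ((IntSet M β × Elt (omega M)) ×
        IntSet M (Elt (omega M) × β)) × Elt (omega M) => q.2.1 ∈ q.1.1.2.1 :=
      (isInternalFun_elt_mem (omega M) (omega M)).comp (g := fun q : ((IntSet M β × Elt (omega M)) ×
        IntSet M (Elt (omega M) × β)) × Elt (omega M) => (q.2, q.1.1.2)) (by fun_prop)
    have h1 : IsInternalFun M fun q : (((IntSet M β × Elt (omega M)) ×
        IntSet M (Elt (omega M) × β)) × Elt (omega M)) × β => q.1.2.1 ∈ q.1.1.1.2.1 :=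
      h0.comp (g := fun q : (((IntSet M β × Elt (omega M)) ×
        IntSet M (Elt (omega M) × β)) × Elt (omega M)) × β => q.1) (by fun_prop)
    have h2 : IsInternalFun M fun S : IntSet M β => ∃ n : Elt (omega M),
        ∃ G : IntSet M (Elt (omega M) × β), (∀ a b, (a, b) ∈ G → a.1 ∈ n.1 ∧ b ∈ S) ∧
        (∀ a, a.1 ∈ n.1 → ∃ b, (a, b) ∈ G) ∧ (∀ b, b ∈ S → ∃ a, (a, b) ∈ G) ∧
        (∀ a b c, (a, b) ∈ G → (a, c) ∈ G → b = c) ∧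
        (∀ a b c, (a, c) ∈ G → (b, c) ∈ G → a = b) := by
      refine .exists (.exists (.and (.forall (.forall (.imp ?_ (.and h1 ?_))))
        (.and (.forall (.imp h0 ?_)) ?_))) <;> fun_prop
    refine h2.congr_prop fun S => ?_
    simp only [isFinite_iff, isBijRel_iff]
    rfl
  exact h.comp hf

theorem IsFinite.isInternalSet [IsSmall M α] {S : Set α} (h : IsFinite M S) :
    IsInternalSet M S := by
  obtain ⟨n, G, hG⟩ := isFinite_iff.1 h
  have : S = {a | ∃ k, (k, a) ∈ G} :=
    Set.ext fun a => ⟨fun ha => hG.right a ha, fun ⟨k, hk⟩ => (hG.mem _ _ hk).2⟩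
  rw [this]
  exact IsInternalFun.isInternalSet (by fun_prop)

theorem isFinite_of_forall_not_mem {S : Set α} [IsSmall M α] (h : ∀ a, a ∉ S) : IsFinite M S := by
  obtain ⟨e, he⟩ := exists_forall_not_mem (M := M)
  refine isFinite_iff.2 ⟨⟨e, mem_omega.2 fun a h _ => h e he⟩, IntSet.mk (fun _ => False)
    (by fun_prop), ?_⟩
  exact ⟨fun _ _ h => h.elim, fun k hk => (he _ hk).elim, fun a ha => (h a ha).elim,
    fun _ _ _ h => h.elim, fun _ _ _ h => h.elim⟩

theorem IsFinite.insert [IsSmall M α] {S T : Set α} {a : α} (hS : IsFinite M S)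
    (h : ∀ x, x ∈ T ↔ x ∈ S ∨ x = a) : IsFinite M T := by
  by_cases ha : a ∈ S
  · have : T = S := Set.ext fun x => (h x).trans ⟨fun h => h.elim (fun h => h) fun h => h ▸ ha, .inl⟩
    rwa [this]
  obtain ⟨n, G, hG⟩ := isFinite_iff.1 hS
  obtain ⟨s, hs⟩ := exists_succ n.1
  have hsω : IsNat s := fun a h1 h2 => h2 n.1 (mem_omega.1 n.2 a h1 h2) s hs
  refine isFinite_iff.2 ⟨⟨s, mem_omega.2 hsω⟩,
    IntSet.mk (fun p => p ∈ G ∨ (p.1 = n ∧ p.2 = a)) (by fun_prop), ?_⟩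
  have hn : ∀ b, ¬ (n, b) ∈ G := fun b hb => not_mem_self _ (hG.mem _ _ hb).1
  have ha' : ∀ k, ¬ (k, a) ∈ G := fun b hb => ha (hG.mem _ _ hb).2
  refine ⟨?_, ?_, ?_, ?_, ?_⟩
  · rintro k b (hk | ⟨rfl, rfl⟩)
    · exact ⟨(hs _).2 (Or.inl (hG.mem _ _ hk).1), (h _).2 (Or.inl (hG.mem _ _ hk).2)⟩
    · exact ⟨(hs _).2 (Or.inr rfl), (h _).2 (Or.inr rfl)⟩
  · intro k hk
    rcases (hs _).1 hk with hk | hk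
    · obtain ⟨b, hb⟩ := hG.left k hk
      exact ⟨b, Or.inl hb⟩
    · exact ⟨a, Or.inr ⟨Subtype.ext hk, rfl⟩⟩
  · intro b hb
    rcases (h _).1 hb with hb | rfl
    · obtain ⟨k, hk⟩ := hG.right b hb
      exact ⟨k, Or.inl hk⟩
    · exact ⟨n, Or.inr ⟨rfl, rfl⟩⟩
  · rintro k b c (h1 | ⟨rfl, rfl⟩) (h2 | ⟨h3, rfl⟩)
    · exact hG.unique _ _ _ h1 h2
    · cases h3
      exact (hn _ h1).elim
    · exact (hn _ h2).elim
    · rfl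
  · rintro k l c (h1 | ⟨rfl, rfl⟩) (h2 | ⟨h3, h4⟩)
    · exact hG.inj _ _ _ h1 h2
    · cases h4
      exact (ha' _ h1).elim
    · exact (ha' _ h2).elim
    · exact h3.symm

/-- Induction on the number `n`, simultaneously for all sets and all bijections from `n` onto them.
Only internal predicates are allowed: the naturals of the model may be nonstandard. -/
theorem isFinite_induction [IsSmall M α] {P : IntSet M α → Prop} (hP : IsInternalFun M P)
    (empty : ∀ S : IntSet M α, (∀ a, ¬ a ∈ S) → P S)
    (insert : ∀ (S T : IntSet M α) (a : α), IsFinite M S.1 → ¬ a ∈ S →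
      (∀ x, x ∈ T ↔ x ∈ S ∨ x = a) → P S → P T)
    (S : IntSet M α) (hS : IsFinite M S.1) : P S := by
  suffices H : ∀ n : Elt (omega M), ∀ (G : IntSet M (Elt (omega M) × α)) (S : IntSet M α),
      (∀ a b, (a, b) ∈ G → a.1 ∈ n.1 ∧ b ∈ S) ∧
        (∀ a, a.1 ∈ n.1 → ∃ b, (a, b) ∈ G) ∧ (∀ b, b ∈ S → ∃ a, (a, b) ∈ G) ∧
        (∀ a b c, (a, b) ∈ G → (a, c) ∈ G → b = c) ∧
        (∀ a b c, (a, c) ∈ G → (b, c) ∈ G → a = b) → P S by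
    obtain ⟨n, G, hG⟩ := isFinite_iff.1 hS
    exact H n G S (isBijRel_iff.1 hG)
  refine omega_induction ?_ ?_ ?_
  · have h0 : IsInternalFun M fun q : ((Elt (omega M) × IntSet M (Elt (omega M) × α)) ×
        IntSet M α) × Elt (omega M) => q.2.1 ∈ q.1.1.1.1 :=
      (isInternalFun_elt_mem (omega M) (omega M)).comp (g := fun q : ((Elt (omega M) ×
        IntSet M (Elt (omega M) × α)) × IntSet M α) × Elt (omega M) => (q.2, q.1.1.1))
        (by fun_prop)
    have h1 : IsInternalFun M fun q : (((Elt (omega M) × IntSet M (Elt (omega M) × α)) ×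
        IntSet M α) × Elt (omega M)) × α => q.1.2.1 ∈ q.1.1.1.1.1 :=
      h0.comp (g := fun q : (((Elt (omega M) × IntSet M (Elt (omega M) × α)) ×
        IntSet M α) × Elt (omega M)) × α => q.1) (by fun_prop)
    refine .forall (.forall (.imp (.and (.forall (.forall (.imp ?_ (.and h1 ?_))))
        (.and (.forall (.imp h0 ?_)) ?_)) ?_)) <;> fun_prop
  · intro e he G S hG
    refine empty S fun a ha => ?_
    obtain ⟨k, hk⟩ := hG.2.2.1 a ha
    exact he _ (hG.1 _ _ hk).1
  · intro n s hs ih G S hG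
    obtain ⟨hG1, hG2, hG3, hG4, hG5⟩ := hG
    obtain ⟨a, ha⟩ := hG2 n ((hs _).2 (Or.inr rfl))
    -- Removing the image `a` of the last element `n` leaves a bijection from `n` onto the remaining
    -- set.
    let S' : IntSet M α := IntSet.mk (fun b => b ∈ S ∧ b ≠ a) (by fun_prop)
    let G' : IntSet M (Elt (omega M) × α) := IntSet.mk (fun p => p ∈ G ∧ p.1 ≠ n) (by fun_prop)
    have hG' : IsBijRel (fun k b => (k, b) ∈ G') (fun k => k.1 ∈ n.1) (· ∈ S') := by
      refine ⟨?_, ?_, ?_, ?_, ?_⟩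
      · rintro k b ⟨h1, h2⟩
        refine ⟨((hs _).1 (hG1 _ _ h1).1).resolve_right fun h => h2 (Subtype.ext h),
          (hG1 _ _ h1).2, ?_⟩
        rintro rfl
        exact h2 (hG5 _ _ _ h1 ha)
      · intro k hk
        obtain ⟨b, hb⟩ := hG2 k ((hs _).2 (Or.inl hk))
        refine ⟨b, hb, ?_⟩
        rintro rfl
        exact not_mem_self _ hk
      · rintro b ⟨hb, hba⟩
        obtain ⟨k, hk⟩ := hG3 b hb
        refine ⟨k, hk, ?_⟩
        rintro rfl
        exact hba (hG4 _ _ _ hk ha)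
      · exact fun k b c h1 h2 => hG4 _ _ _ h1.1 h2.1
      · exact fun k b c h1 h2 => hG5 _ _ _ h1.1 h2.1
    refine insert S' S a (isFinite_iff.2 ⟨n, G', hG'⟩) (fun h => h.2 rfl) (fun x => ?_)
      (ih G' S' (isBijRel_iff.1 hG'))
    by_cases hx : x = a
    · subst hx
      simp only [or_true, iff_true]
      exact (hG1 _ _ ha).2
    · simp [S', hx]

/-! ### Finite sets as members of a type, and their closure properties -/

instance [IsSmall M α] : IsSmall M (FinSub M α) :=
  IsSmall.subtype (p := fun S : IntSet M α => IsFinite M S.1) (by fun_prop)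

variable (M α) in
/-- The empty set, as a finite set. -/
def FinSub.empty [IsSmall M α] : FinSub M α :=
  ⟨IntSet.mk (fun _ => False) (by fun_prop), isFinite_of_forall_not_mem fun _ h => h⟩

/-- The finite set `F ∪ {a}`. -/
def FinSub.insert [IsSmall M α] (F : FinSub M α) (a : α) : FinSub M α :=
  ⟨IntSet.mk (fun x => x ∈ F.1 ∨ x = a) (by fun_prop), F.2.insert fun _ => Iff.rfl⟩

@[simp]
theorem FinSub.not_mem_empty [IsSmall M α] (a : α) : ¬ a ∈ (FinSub.empty M α).1 := fun h => h

@[simp]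
theorem FinSub.mem_insert [IsSmall M α] {F : FinSub M α} {a b : α} :
    b ∈ (F.insert a).1 ↔ b ∈ F.1 ∨ b = a := Iff.rfl

theorem FinSub.ext {F G : FinSub M α} (h : ∀ a, a ∈ F.1 ↔ a ∈ G.1) : F = G :=
  Subtype.ext (IntSet.ext h)

theorem FinSub.induction [IsSmall M α] {P : FinSub M α → Prop} (hP : IsInternalFun M P)
    (empty : P (FinSub.empty M α))
    (insert : ∀ F a, ¬ a ∈ F.1 → P F → P (F.insert a)) (F : FinSub M α) : P F := by
  have key := isFinite_induction (P := fun S : IntSet M α => ∀ F : FinSub M α, F.1 = S → P F)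
    (by fun_prop) ?_ ?_ F.1 F.2
  · exact key F rfl
  · intro S hS F hF
    rwa [show F = FinSub.empty M α from FinSub.ext fun a => iff_of_false (hF ▸ hS a) fun h => h]
  · intro S T a hS ha hT ih F hF
    have : F = FinSub.insert ⟨S, hS⟩ a := FinSub.ext fun x => by rw [hF, hT]; rfl
    rw [this]
    exact insert _ _ ha (ih _ rfl)

/-- Induction on the larger set for all subsets at once; the new point is deleted from the subset if
it occurs there. -/
theorem IsFinite.subset [IsSmall M α] {S T : Set α} (hS : IsFinite M S) (hT : IsInternalSet M T)
    (h : ∀ a ∈ T, a ∈ S) : IsFinite M T := by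
  have key := FinSub.induction (P := fun F : FinSub M α => ∀ T : IntSet M α,
    (∀ a, a ∈ T → a ∈ F.1) → IsFinite M T.1) (by fun_prop) ?_ ?_ ⟨⟨S, hS.isInternalSet⟩, hS⟩
    ⟨T, hT⟩ h
  · exact key
  · exact fun T hT => isFinite_of_forall_not_mem hT
  · intro F a ha ih T hT
    have h1 := ih (IntSet.mk (fun x => x ∈ T ∧ x ≠ a) (by fun_prop)) fun x hx =>
      (hT x hx.1).resolve_right hx.2
    by_cases haT : a ∈ T
    · refine h1.insert (a := a) fun x => ?_
      change x ∈ T ↔ (x ∈ T ∧ x ≠ a) ∨ x = a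
      by_cases hx : x = a <;> simp [hx, haT]
    · rwa [show T = IntSet.mk (fun x => x ∈ T ∧ x ≠ a) (by fun_prop) from IntSet.ext fun x =>
        ⟨fun hx => ⟨hx, fun h => haT (h ▸ hx)⟩, fun hx => hx.1⟩]

theorem IsFinite.union [IsSmall M α] {S T : Set α} (hS : IsFinite M S) (hT : IsFinite M T) :
    IsFinite M {a | a ∈ S ∨ a ∈ T} := by
  obtain ⟨S₀, rfl⟩ : ∃ S₀ : IntSet M α, S₀.1 = S := ⟨⟨S, hS.isInternalSet⟩, rfl⟩
  obtain ⟨T₀, rfl⟩ : ∃ T₀ : IntSet M α, T₀.1 = T := ⟨⟨T, hT.isInternalSet⟩, rfl⟩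
  have := FinSub.induction (P := fun F : FinSub M α => ∀ T S : IntSet M α, IsFinite M S.1 →
    (∀ a, a ∈ T ↔ a ∈ S ∨ a ∈ F.1) → IsFinite M T.1) (by fun_prop) ?_ ?_
    ⟨T₀, hT⟩
    (IntSet.mk (fun a => a ∈ S₀ ∨
      a ∈ T₀) (by fun_prop)) S₀ hS
      fun _ => Iff.rfl
  · exact this
  · intro T S hS hT
    rwa [show T = S from IntSet.ext fun a => by simp [hT]]
  · intro F a ha ih T S hS hT
    refine ih T (IntSet.mk (fun x => x ∈ S ∨ x = a) (by fun_prop)) (hS.insert fun _ => Iff.rfl)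
      fun x => ?_
    rw [hT, FinSub.mem_insert, IntSet.mem_mk]
    tauto

theorem IsFinite.biUnion [IsSmall M α] [IsSmall M β] (F : FinSub M α) {R : α → β → Prop}
    (hR : IsInternalFun M fun p : α × β => R p.1 p.2)
    (h : ∀ a, a ∈ F.1 → IsFinite M {b | R a b}) : IsFinite M {b | ∃ a, a ∈ F.1 ∧ R a b} := by
  have key := FinSub.induction (P := fun G : FinSub M α => (∀ a, a ∈ G.1 → a ∈ F.1) →
    ∀ T : IntSet M β, (∀ b, b ∈ T ↔ ∃ a, a ∈ G.1 ∧ R a b) → IsFinite M T.1) ?_ ?_ ?_ F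
    (fun _ h => h) (IntSet.mk (fun b => ∃ a, a ∈ F.1 ∧ R a b) (by fun_prop)) fun _ => Iff.rfl
  · exact key
  · fun_prop
  · intro _ T hT
    exact isFinite_of_forall_not_mem fun b hb => by
      obtain ⟨a, ha, -⟩ := (hT b).1 hb
      exact ha
  · intro G a ha ih hG T hT
    have h1 := ih (fun x hx => hG x (Or.inl hx))
      (IntSet.mk (fun b => ∃ a, a ∈ G.1 ∧ R a b) (by fun_prop)) fun _ => Iff.rfl
    have h2 := h1.union (h a (hG a (Or.inr rfl)))
    convert h2 using 1
    ext b
    refine (hT b).trans ⟨?_, ?_⟩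
    · rintro ⟨x, hx | rfl, hb⟩
      · exact Or.inl ⟨x, hx, hb⟩
      · exact Or.inr hb
    · rintro (⟨x, hx, hb⟩ | hb)
      · exact ⟨x, Or.inl hx, hb⟩
      · exact ⟨a, Or.inr rfl, hb⟩

end

/-! ### Sums over finite sets -/

section

/-- Addition is an operation of the model. -/
class InternalAdd (M : Type u) [Membership M M] [IsZF M] (β : Type w) [Coded M β] [Add β] :
    Prop where
  add_internal : IsInternalFun M fun p : β × β => p.1 + p.2

variable {M : Type u} [Membership M M] [IsZF M] {α : Type v} {β : Type w} {γ : Type x}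
  [Coded M α] [Coded M β] [Coded M γ] [IsSmall M α] [IsSmall M β] [IsSmall M γ]

@[fun_prop]
theorem IsInternalFun.add [Add β] [InternalAdd M β] {f g : α → β} (hf : IsInternalFun M f)
    (hg : IsInternalFun M g) : IsInternalFun M fun a => f a + g a :=
  (InternalAdd.add_internal (M := M) (β := β)).comp (hf.prodMk hg)

/-- The finite set `F \ {a}`. -/
def FinSub.erase (F : FinSub M α) (a : α) : FinSub M α :=
  ⟨IntSet.mk (fun x => x ∈ F.1 ∧ x ≠ a) (by fun_prop),
    F.2.subset (IsInternalFun.isInternalSet (P := fun x => x ∈ F.1 ∧ x ≠ a) (by fun_prop))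
      fun x hx => hx.1⟩

@[simp]
theorem FinSub.mem_erase {F : FinSub M α} {a b : α} :
    b ∈ (F.erase a).1 ↔ b ∈ F.1 ∧ b ≠ a := Iff.rfl

theorem FinSub.insert_erase {F : FinSub M α} {a : α} (h : a ∈ F.1) : (F.erase a).insert a = F :=
  FinSub.ext fun x => by
    by_cases hx : x = a <;> simp [hx, h]

@[fun_prop]
theorem IsInternalFun.erase {f : β → FinSub M α} {g : β → α} (hf : IsInternalFun M f)
    (hg : IsInternalFun M g) : IsInternalFun M fun b => (f b).erase (g b) := by
  refine IsInternalFun.comp (f := fun p : FinSub M α × α => p.1.erase p.2) ?_ (hf.prodMk hg)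
  refine IsInternalFun.of_val (isInternalFun_intSet ?_)
  change IsInternalFun M fun p : (FinSub M α × α) × α => p.2 ∈ p.1.1.1 ∧ p.2 ≠ p.1.2
  fun_prop

@[fun_prop]
theorem IsInternalFun.insert {f : β → FinSub M α} {g : β → α} (hf : IsInternalFun M f)
    (hg : IsInternalFun M g) : IsInternalFun M fun b => (f b).insert (g b) := by
  refine IsInternalFun.comp (f := fun p : FinSub M α × α => p.1.insert p.2) ?_ (hf.prodMk hg)
  refine IsInternalFun.of_val (isInternalFun_intSet ?_)
  change IsInternalFun M fun p : (FinSub M α × α) × α => p.2 ∈ p.1.1.1 ∨ p.2 = p.1.2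
  fun_prop

theorem FinSub.eq_empty {E : FinSub M α} (h : ∀ a, ¬ a ∈ E.1) : E = FinSub.empty M α :=
  FinSub.ext fun a => iff_of_false (h a) fun h => h

section

variable [AddCommMonoid β]

/-- The function `T` is `E ↦ ∑_{x ∈ E} g x` on the subsets of the finite set `F`. -/
def IsLocalSum (g : α → β) (F : FinSub M α) (T : IntFun M (FinSub M α) β) : Prop :=
  T.1 (FinSub.empty M α) = 0 ∧ ∀ (E : FinSub M α) (a : α), ¬ a ∈ E.1 →
    (∀ x, x ∈ E.1 ∨ x = a → x ∈ F.1) → T.1 (E.insert a) = T.1 E + g a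

theorem IsLocalSum.mono {g : α → β} {F G : FinSub M α} {T : IntFun M (FinSub M α) β}
    (hT : IsLocalSum g F T) (h : ∀ x, x ∈ G.1 → x ∈ F.1) : IsLocalSum g G T :=
  ⟨hT.1, fun E a ha hE => hT.2 E a ha fun x hx => h x (hE x hx)⟩

/-- Makes the sum independent of the chosen recursion, which is what renders it definable in
`IsInternalFun.fsum`. -/
theorem IsLocalSum.unique {g : α → β} {F : FinSub M α} {T T' : IntFun M (FinSub M α) β}
    (hT : IsLocalSum g F T) (hT' : IsLocalSum g F T') (G : FinSub M α)
    (hG : ∀ x, x ∈ G.1 → x ∈ F.1) : T.1 G = T'.1 G := by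
  refine FinSub.induction (P := fun G : FinSub M α => (∀ x, x ∈ G.1 → x ∈ F.1) →
    T.1 G = T'.1 G) (by fun_prop) ?_ ?_ G hG
  · intro _
    rw [hT.1, hT'.1]
  · intro E a ha ih hE
    rw [hT.2 E a ha hE, hT'.2 E a ha hE, ih fun x hx => hE x (Or.inl hx)]

variable [InternalAdd M β]

@[fun_prop]
theorem IsInternalFun.isLocalSum {g : γ → α → β} {F : γ → FinSub M α}
    {T : γ → IntFun M (FinSub M α) β} (hg : IsInternalFun M fun p : γ × α => g p.1 p.2)
    (hF : IsInternalFun M F) (hT : IsInternalFun M T) :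
    IsInternalFun M fun c => IsLocalSum (g c) (F c) (T c) := by
  unfold IsLocalSum
  have hg' : IsInternalFun M fun p : (γ × FinSub M α) × α => g p.1.1 p.2 :=
    hg.comp (g := fun p : (γ × FinSub M α) × α => (p.1.1, p.2)) (by fun_prop)
  fun_prop

-- Recursion over finite sets without an order: the function on all subsets of F is built by
-- induction on F, and commutativity makes the order of insertion irrelevant.
open Classical in
theorem exists_isLocalSum {g : α → β} (hg : IsInternalFun M g) (F : FinSub M α) :
    ∃ T, IsLocalSum g F T := by
  refine FinSub.induction (P := fun F : FinSub M α => ∃ T, IsLocalSum g F T) ?_ ?_ ?_ F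
  · have : IsInternalFun M fun p : (FinSub M α × IntFun M (FinSub M α) β) × α => g p.2 :=
      hg.comp (by fun_prop)
    fun_prop
  · refine ⟨⟨fun _ => 0, by fun_prop⟩, rfl, fun E a _ h => ?_⟩
    exact (h a (Or.inr rfl)).elim
  · rintro F a ha ⟨T, hT0, hT⟩
    -- Subsets containing the new point get their sum from the subset without it. Values off the
    -- subsets of F are unconstrained.
    refine ⟨⟨fun G => if a ∈ G.1 then T.1 (G.erase a) + g a else T.1 G, by fun_prop⟩, ?_, ?_⟩
    · simp [hT0]
    · intro E b hb hE
      have hEF : ∀ x, x ∈ E.1 → x ≠ a → x ∈ F.1 := fun x hx hxa =>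
        (hE x (Or.inl hx)).resolve_right hxa
      by_cases hba : b = a
      · subst hba
        have : (E.insert b).erase b = E := FinSub.ext fun x => by
          simp only [FinSub.mem_erase, FinSub.mem_insert]
          refine ⟨fun h => h.1.resolve_right h.2, fun h => ⟨Or.inl h, ?_⟩⟩
          rintro rfl
          exact hb h
        simp [hb, this]
      · have hbF : b ∈ F.1 := (hE b (Or.inr rfl)).resolve_right hba
        by_cases haE : a ∈ E.1
        · have h1 : (E.insert b).erase a = (E.erase a).insert b := FinSub.ext fun x => by
            simp only [FinSub.mem_erase, FinSub.mem_insert]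
            by_cases hx : x = b <;> simp [hx, hba]
          have h2 := hT (E.erase a) b (fun h => hb h.1) fun x hx => by
            rcases hx with hx | rfl
            · exact hEF x hx.1 hx.2
            · exact hbF
          simp only [FinSub.mem_insert, haE, true_or, if_true, h1, h2]
          rw [add_right_comm]
        · have h2 := hT E b hb fun x hx => by
            rcases hx with hx | rfl
            · exact hEF x hx fun h => haE (h ▸ hx)
            · exact hbF
          simp [haE, Ne.symm hba, h2]

open Classical in
/-- `∑_{x ∈ F} g x`. -/
noncomputable def fsum (g : α → β) (F : FinSub M α) : β :=
  if h : ∃ T, IsLocalSum g F T then (Classical.choose h).1 F else 0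

theorem IsLocalSum.eq_fsum {g : α → β} {F : FinSub M α} {T : IntFun M (FinSub M α) β}
    (hT : IsLocalSum g F T) : T.1 F = fsum g F := by
  have h : ∃ T, IsLocalSum g F T := ⟨T, hT⟩
  rw [fsum, dif_pos h]
  exact hT.unique (Classical.choose_spec h) F fun _ hx => hx

theorem fsum_empty (g : α → β) : fsum g (FinSub.empty M α) = 0 := by
  unfold fsum
  split_ifs with h
  · exact (Classical.choose_spec h).1
  · rfl

theorem fsum_insert {g : α → β} (hg : IsInternalFun M g) {F : FinSub M α} {a : α}
    (ha : ¬ a ∈ F.1) : fsum g (F.insert a) = fsum g F + g a := by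
  obtain ⟨T, hT⟩ := exists_isLocalSum hg (F.insert a)
  have h1 : IsLocalSum g F T := hT.mono fun x hx => Or.inl hx
  rw [← hT.eq_fsum, ← h1.eq_fsum]
  exact hT.2 F a ha fun x hx => hx

theorem fsum_singleton {g : α → β} (hg : IsInternalFun M g) (a : α) :
    fsum g ((FinSub.empty M α).insert a) = g a := by
  rw [fsum_insert hg (by simp), fsum_empty, zero_add]

-- Uniform in a parameter: by existence and uniqueness of local sums, the value is defined by "some
-- local sum takes this value at F", a formula over coded types.
@[fun_prop]
theorem IsInternalFun.fsum {g : γ → α → β} {F : γ → FinSub M α}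
    (hg : IsInternalFun M fun p : γ × α => g p.1 p.2) (hF : IsInternalFun M F) :
    IsInternalFun M fun c => fsum (g c) (F c) := by
  refine IsInternalFun.of_graph
    (P := fun c s => ∃ T : IntFun M (FinSub M α) β, IsLocalSum (g c) (F c) T ∧ T.1 (F c) = s)
    ?_ fun c s => ⟨?_, ?_⟩
  · have hg' : IsInternalFun M fun p : ((γ × β) × IntFun M (FinSub M α) β) × α =>
        g p.1.1.1 p.2 :=
      hg.comp (g := fun p : ((γ × β) × IntFun M (FinSub M α) β) × α => (p.1.1.1, p.2))
        (by fun_prop)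
    fun_prop
  · rintro ⟨T, hT, rfl⟩
    exact hT.eq_fsum
  · rintro rfl
    have hgc : IsInternalFun M (g c) := hg.comp (g := fun a => (c, a)) (by fun_prop)
    obtain ⟨T, hT⟩ := exists_isLocalSum hgc (F c)
    exact ⟨T, hT, hT.eq_fsum⟩

@[fun_prop]
theorem IsInternalFun.fsum_const_left {g : α → β} {F : γ → FinSub M α}
    (hg : IsInternalFun M g) (hF : IsInternalFun M F) :
    IsInternalFun M fun c => ZFModel.fsum g (F c) :=
  IsInternalFun.fsum (g := fun _ => g) (hg.comp (by fun_prop)) hF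

theorem isFinSum_fsum {g : α → β} (hg : IsInternalFun M g) :
    IsFinSum (M := M) g (fsum g) where
  internal := by fun_prop
  empty F hF := by
    rw [FinSub.eq_empty (E := F) fun a ha => (congrArg (a ∈ ·) hF).mp ha, fsum_empty]
  insert F G a ha hG := by
    rw [← fsum_insert hg ha]
    congr 1
    refine FinSub.ext fun x => ?_
    refine (iff_of_eq (congrArg (x ∈ ·) hG)).trans ?_
    exact Or.comm

theorem IsFinSum.eq_fsum {g : α → β} (hg : IsInternalFun M g) {S : FinSub M α → β}
    (hS : IsFinSum g S) (F : FinSub M α) : S F = ZFModel.fsum g F := by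
  have hS' := hS.internal
  refine FinSub.induction (P := fun F : FinSub M α => S F = ZFModel.fsum g F) (by fun_prop) ?_ ?_ F
  · rw [fsum_empty]
    exact hS.empty _ (Set.ext fun x => iff_of_false (fun h => h) fun h => h)
  · intro F a ha ih
    rw [fsum_insert hg ha, ← ih]
    exact hS.insert F _ a ha (Set.ext fun x => Or.comm)

theorem fsum_congr {g h : α → β} (hg : IsInternalFun M g) (hh : IsInternalFun M h)
    (F : FinSub M α) (H : ∀ a, a ∈ F.1 → g a = h a) : fsum g F = fsum h F := by
  refine FinSub.induction (P := fun F : FinSub M α => (∀ a, a ∈ F.1 → g a = h a) →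
    fsum g F = fsum h F) (by fun_prop) ?_ ?_ F H
  · intro _
    rw [fsum_empty, fsum_empty]
  · intro F a ha ih H
    rw [fsum_insert hg ha, fsum_insert hh ha, H a (Or.inr rfl), ih fun x hx => H x (Or.inl hx)]

theorem fsum_zero (F : FinSub M α) : fsum (fun _ : α => (0 : β)) F = 0 := by
  refine FinSub.induction (P := fun F : FinSub M α => fsum (fun _ : α => (0 : β)) F = 0)
    (by fun_prop) (fsum_empty _) ?_ F
  intro F a ha ih
  rw [fsum_insert (by fun_prop) ha, ih, add_zero]

theorem fsum_add {g h : α → β} (hg : IsInternalFun M g) (hh : IsInternalFun M h)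
    (F : FinSub M α) : fsum (fun a => g a + h a) F = fsum g F + fsum h F := by
  refine FinSub.induction (P := fun F : FinSub M α => fsum (fun a => g a + h a) F =
    fsum g F + fsum h F) (by fun_prop) ?_ ?_ F
  · rw [fsum_empty, fsum_empty, fsum_empty, add_zero]
  · intro F a ha ih
    rw [fsum_insert (by fun_prop) ha, fsum_insert hg ha, fsum_insert hh ha, ih]
    exact add_add_add_comm _ _ _ _

theorem fsum_comm {g : α → γ → β} (hg : IsInternalFun M fun p : α × γ => g p.1 p.2)
    (F : FinSub M α) (G : FinSub M γ) :
    fsum (fun a => fsum (g a) G) F = fsum (fun c => fsum (fun a => g a c) F) G := by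
  have hg1 : ∀ a, IsInternalFun M (g a) := fun a =>
    hg.comp (g := fun c => (a, c)) (by fun_prop)
  have hg2 : IsInternalFun M fun q : γ × α => g q.2 q.1 :=
    hg.comp (g := fun q : γ × α => (q.2, q.1)) (by fun_prop)
  have hg2' : ∀ c, IsInternalFun M fun a => g a c := fun c =>
    hg.comp (g := fun a => (a, c)) (by fun_prop)
  have hg3 : IsInternalFun M fun a => fsum (g a) G := IsInternalFun.fsum hg (by fun_prop)
  have hg4 : ∀ F : FinSub M α, IsInternalFun M fun c => fsum (fun a => g a c) F := fun F =>
    IsInternalFun.fsum (g := fun c a => g a c) hg2 (by fun_prop)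
  have hg5 : IsInternalFun M fun p : FinSub M α × γ => fsum (fun a => g a p.2) p.1 :=
    IsInternalFun.fsum (g := fun (p : FinSub M α × γ) a => g a p.2)
      (hg.comp (g := fun q : (FinSub M α × γ) × α => (q.2, q.1.2)) (by fun_prop)) (by fun_prop)
  refine FinSub.induction (P := fun F : FinSub M α =>
    fsum (fun a => fsum (g a) G) F = fsum (fun c => fsum (fun a => g a c) F) G) ?_ ?_ ?_ F
  · exact .eq (IsInternalFun.fsum_const_left hg3 (by fun_prop))
      (IsInternalFun.fsum (g := fun (F : FinSub M α) c => fsum (fun a => g a c) F) hg5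
        (by fun_prop))
  · simp only [fsum_empty, fsum_zero]
  · intro F a ha ih
    rw [fsum_insert hg3 ha, ih, ← fsum_add (hg4 F) (hg1 a)]
    congr 1
    funext c
    exact (fsum_insert (hg2' c) ha).symm

theorem fsum_eq_of_support {g : α → β} (hg : IsInternalFun M g) (F G : FinSub M α)
    (h : ∀ a, a ∈ G.1 → a ∈ F.1) (h0 : ∀ a, ¬ a ∈ G.1 → g a = 0) : fsum g F = fsum g G := by
  refine FinSub.induction (P := fun F : FinSub M α => ∀ G : FinSub M α, (∀ a, a ∈ G.1 → a ∈ F.1) →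
    (∀ a, a ∈ F.1 → ¬ a ∈ G.1 → g a = 0) → fsum g F = fsum g G) (by fun_prop) ?_ ?_ F G h
      fun a _ => h0 a
  · intro G hG _
    rw [FinSub.eq_empty (E := G) hG]
  · intro F a ha ih G hG hFG
    rw [fsum_insert hg ha]
    by_cases haG : a ∈ G.1
    · rw [ih (G.erase a) (fun x hx => (hG x hx.1).resolve_right hx.2), ← fsum_insert hg (by simp),
        FinSub.insert_erase haG]
      intro x hx hxG
      exact hFG x (Or.inl hx) fun h => hxG ⟨h, fun h => ha (h ▸ hx)⟩
    · rw [hFG a (Or.inr rfl) haG, add_zero]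
      refine ih G (fun x hx => (hG x hx).resolve_right fun h => haG (h ▸ hx)) fun x hx =>
        hFG x (Or.inl hx)

end

end

/-! ### Real and complex numbers -/

section

variable {M : Type u} [Membership M M] [IsZF M] {α : Type v} {β : Type w} {γ : Type x}
  [Coded M α] [Coded M β] [Coded M γ] [IsSmall M α] [IsSmall M β] [IsSmall M γ]

@[fun_prop]
theorem IsInternalFun.equipotent {f : α → IntSet M β} {g : α → IntSet M γ}
    (hf : IsInternalFun M f) (hg : IsInternalFun M g) :
    IsInternalFun M fun a => Equipotent M (f a).1 (g a).1 := by
  have h : IsInternalFun M fun p : IntSet M β × IntSet M γ => ∃ G : IntSet M (β × γ),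
      (∀ a b, (a, b) ∈ G → a ∈ p.1 ∧ b ∈ p.2) ∧
        (∀ a, a ∈ p.1 → ∃ b, (a, b) ∈ G) ∧ (∀ b, b ∈ p.2 → ∃ a, (a, b) ∈ G) ∧
        (∀ a b c, (a, b) ∈ G → (a, c) ∈ G → b = c) ∧
        (∀ a b c, (a, c) ∈ G → (b, c) ∈ G → a = b) := by
    fun_prop
  refine (h.comp (hf.prodMk hg)).congr_prop fun a => ?_
  rw [equipotent_iff]
  exact exists_congr fun G => isBijRel_iff.symm

theorem Equipotent.insert {F : FinSub M α} {G : FinSub M β} (h : Equipotent M F.1.1 G.1.1) {a : α}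
    {b : β} (ha : ¬ a ∈ F.1) (hb : ¬ b ∈ G.1) :
    Equipotent M (F.insert a).1.1 (G.insert b).1.1 := by
  obtain ⟨H, hH⟩ := equipotent_iff.1 h
  have ha' : ∀ c, ¬ (a, c) ∈ H := fun c h => ha (hH.mem _ _ h).1
  have hb' : ∀ c, ¬ (c, b) ∈ H := fun c h => hb (hH.mem _ _ h).2
  refine equipotent_iff.2 ⟨IntSet.mk (fun p => p ∈ H ∨ (p.1 = a ∧ p.2 = b)) (by fun_prop),
    ?_, ?_, ?_, ?_, ?_⟩
  · rintro x y (h | ⟨rfl, rfl⟩)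
    · exact ⟨Or.inl (hH.mem _ _ h).1, Or.inl (hH.mem _ _ h).2⟩
    · exact ⟨Or.inr rfl, Or.inr rfl⟩
  · rintro x (hx | rfl)
    · obtain ⟨y, hy⟩ := hH.left x hx
      exact ⟨y, Or.inl hy⟩
    · exact ⟨b, Or.inr ⟨rfl, rfl⟩⟩
  · rintro x (hx | rfl)
    · obtain ⟨y, hy⟩ := hH.right x hx
      exact ⟨y, Or.inl hy⟩
    · exact ⟨a, Or.inr ⟨rfl, rfl⟩⟩
  · rintro x y z (h1 | ⟨h1, h1'⟩) (h2 | ⟨h2, h2'⟩)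
    · exact hH.unique _ _ _ h1 h2
    · exact (ha' y ((h2 : x = a) ▸ h1)).elim
    · exact (ha' z ((h1 : x = a) ▸ h2)).elim
    · exact h1'.trans h2'.symm
  · rintro x y z (h1 | ⟨h1, h1'⟩) (h2 | ⟨h2, h2'⟩)
    · exact hH.inj _ _ _ h1 h2
    · exact (hb' x ((h2' : z = b) ▸ h1)).elim
    · exact (hb' y ((h1' : z = b) ▸ h2)).elim
    · exact h1.trans h2.symm

section

variable {R : M} [Field (Elt R)] [LinearOrder (Elt R)] [IsStrictOrderedRing (Elt R)]
  [hR : Fact (IsRealField R)]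

instance : InternalAdd M (Elt R) := ⟨hR.out.add_internal⟩

@[fun_prop]
theorem IsInternalFun.mul {f g : α → Elt R} (hf : IsInternalFun M f)
    (hg : IsInternalFun M g) : IsInternalFun M fun a => f a * g a :=
  hR.out.mul_internal.comp (hf.prodMk hg)

@[fun_prop]
theorem IsInternalFun.neg {f : α → Elt R} (hf : IsInternalFun M f) :
    IsInternalFun M fun a => - f a :=
  IsInternalFun.of_graph (P := fun a b => b + f a = 0) (by fun_prop) fun a b =>
    eq_neg_iff_add_eq_zero.symm

@[fun_prop]
theorem IsInternalFun.sub {f g : α → Elt R} (hf : IsInternalFun M f)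
    (hg : IsInternalFun M g) : IsInternalFun M fun a => f a - g a := by
  simp only [sub_eq_add_neg]
  fun_prop

@[fun_prop]
theorem IsInternalFun.le {f g : α → Elt R} (hf : IsInternalFun M f)
    (hg : IsInternalFun M g) : IsInternalFun M fun a => f a ≤ g a :=
  (isInternalFun_prop_iff.2 hR.out.le_internal :
    IsInternalFun M fun p : Elt R × Elt R => p.1 ≤ p.2).comp (hf.prodMk hg)

@[fun_prop]
theorem IsInternalFun.lt {f g : α → Elt R} (hf : IsInternalFun M f)
    (hg : IsInternalFun M g) : IsInternalFun M fun a => f a < g a := by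
  simp only [← not_le]
  fun_prop

omit hR in
instance : IsSmall M (Cpx R) :=
  IsSmall.of_code_eq (α := Elt R × Elt R) (p := fun _ => True)
    (IsInternalFun.isInternalSet (by fun_prop)) (fun z => (z.re, z.im)) (fun _ => rfl)
    fun a => ⟨fun _ => ⟨⟨a.1, a.2⟩, rfl⟩, fun _ => trivial⟩

@[fun_prop]
theorem IsInternalFun.re {f : α → Cpx R} (hf : IsInternalFun M f) :
    IsInternalFun M fun a => (f a).re :=
  IsInternalFun.comp (f := fun z : Cpx R => z.re) (IsInternalFun.comp (f := Prod.fst)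
    (g := fun z : Cpx R => (z.re, z.im)) (by fun_prop) (isInternalFun_of_code_eq fun _ => rfl)) hf

@[fun_prop]
theorem IsInternalFun.im {f : α → Cpx R} (hf : IsInternalFun M f) :
    IsInternalFun M fun a => (f a).im :=
  IsInternalFun.comp (f := fun z : Cpx R => z.im) (IsInternalFun.comp (f := Prod.snd)
    (g := fun z : Cpx R => (z.re, z.im)) (by fun_prop) (isInternalFun_of_code_eq fun _ => rfl)) hf

theorem IsInternalFun.of_re_im {f : α → Cpx R} (h1 : IsInternalFun M fun a => (f a).re)
    (h2 : IsInternalFun M fun a => (f a).im) : IsInternalFun M f :=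
  IsInternalFun.comp (f := fun p : Elt R × Elt R => (⟨p.1, p.2⟩ : Cpx R))
    (isInternalFun_of_code_eq fun _ => rfl) (h1.prodMk h2)

instance : InternalAdd M (Cpx R) :=
  ⟨IsInternalFun.of_re_im
    (by simp only [QuadraticAlgebra.re_add]; fun_prop)
    (by simp only [QuadraticAlgebra.im_add]; fun_prop)⟩

theorem IsInternalFun.mul_star {f g : α → Cpx R} (hf : IsInternalFun M f)
    (hg : IsInternalFun M g) : IsInternalFun M fun a => f a * star (g a) := by
  refine .of_re_im ?_ ?_
  · simp only [QuadraticAlgebra.re_mul, QuadraticAlgebra.re_star, QuadraticAlgebra.im_star]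
    fun_prop
  · simp only [QuadraticAlgebra.im_mul, QuadraticAlgebra.re_star, QuadraticAlgebra.im_star]
    fun_prop

theorem norm_eq (z : Cpx R) : QuadraticAlgebra.norm z = z.re * z.re + z.im * z.im := by
  rw [QuadraticAlgebra.norm_def]
  ring

theorem IsInternalFun.norm {f : α → Cpx R} (hf : IsInternalFun M f) :
    IsInternalFun M fun a => QuadraticAlgebra.norm (f a) := by
  simp only [norm_eq]
  fun_prop

theorem norm_nonneg' (z : Cpx R) : 0 ≤ QuadraticAlgebra.norm z := by
  rw [norm_eq]
  nlinarith [mul_self_nonneg z.re, mul_self_nonneg z.im]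

theorem norm_eq_zero_iff {z : Cpx R} : QuadraticAlgebra.norm z = 0 ↔ z = 0 := by
  rw [norm_eq]
  constructor
  · intro h
    have h1 := mul_self_nonneg z.re
    have h2 := mul_self_nonneg z.im
    exact QuadraticAlgebra.ext (mul_self_eq_zero.1 (by linarith)) (mul_self_eq_zero.1 (by linarith))
  · rintro rfl
    simp

/-! ### Inequalities for finite sums of reals, and cardinality as a real number -/

theorem fsum_le {g h : α → Elt R} (hg : IsInternalFun M g) (hh : IsInternalFun M h)
    (F : FinSub M α) (H : ∀ a, a ∈ F.1 → g a ≤ h a) : fsum g F ≤ fsum h F := by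
  refine FinSub.induction (P := fun F : FinSub M α => (∀ a, a ∈ F.1 → g a ≤ h a) →
    fsum g F ≤ fsum h F) (by fun_prop) ?_ ?_ F H
  · intro _
    rw [fsum_empty, fsum_empty]
  · intro F a ha ih H
    rw [fsum_insert hg ha, fsum_insert hh ha]
    exact add_le_add (ih fun x hx => H x (Or.inl hx)) (H a (Or.inr rfl))

theorem fsum_mono {g : α → Elt R} (hg : IsInternalFun M g) (h0 : ∀ a, 0 ≤ g a)
    (F G : FinSub M α) (h : ∀ a, a ∈ G.1 → a ∈ F.1) : fsum g G ≤ fsum g F := by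
  refine FinSub.induction (P := fun F : FinSub M α => ∀ G : FinSub M α, (∀ a, a ∈ G.1 → a ∈ F.1) →
    fsum g G ≤ fsum g F) (by fun_prop) ?_ ?_ F G h
  · intro G hG
    rw [FinSub.eq_empty (E := G) hG]
  · intro F a ha ih G hG
    rw [fsum_insert hg ha]
    by_cases haG : a ∈ G.1
    · have := ih (G.erase a) fun x hx => (hG x hx.1).resolve_right hx.2
      rw [← FinSub.insert_erase haG, fsum_insert hg (by simp)]
      linarith
    · have := ih G (fun x hx => (hG x hx).resolve_right fun h => haG (h ▸ hx))
      linarith [h0 a]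

variable (R) in
/-- The number of members of a finite set, as a real number. -/
noncomputable def card (F : FinSub M α) : Elt R := fsum (fun _ => 1) F

variable (R) in
theorem card_insert {F : FinSub M α} {a : α} (ha : ¬ a ∈ F.1) :
    card R (F.insert a) = card R F + 1 :=
  fsum_insert (g := fun _ : α => (1 : Elt R)) (by fun_prop) ha

@[fun_prop]
theorem IsInternalFun.card {f : α → FinSub M β} (hf : IsInternalFun M f) :
    IsInternalFun M fun a => card R (f a) := by
  unfold ZFModel.card
  fun_prop

/-- A set which has not fewer members than the finite set `F` has a subset equipotent with `F`. -/
theorem exists_equipotent_subset (S : IntSet M β) (F : FinSub M α)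
    (h : ∀ G : FinSub M β, G.1 = S → card R F ≤ card R G) :
    ∃ G : FinSub M β, (∀ b, b ∈ G.1 → b ∈ S) ∧ card R G = card R F ∧
      Equipotent M F.1.1 G.1.1 := by
  refine FinSub.induction (P := fun F : FinSub M α =>
    (∀ G : FinSub M β, G.1 = S → card R F ≤ card R G) →
    ∃ G : FinSub M β, (∀ b, b ∈ G.1 → b ∈ S) ∧ card R G = card R F ∧
      Equipotent M F.1.1 G.1.1) (by fun_prop) ?_ ?_ F h
  · intro _
    refine ⟨FinSub.empty M β, fun b hb => hb.elim, (fsum_empty (M := M) (α := β) _).trans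
      (fsum_empty (M := M) (α := α) _).symm,
      equipotent_iff.2 ⟨IntSet.mk (fun _ => False) (by fun_prop), ?_⟩⟩
    exact ⟨fun _ _ h => h.elim, fun k hk => hk.elim, fun a ha => ha.elim,
      fun _ _ _ h => h.elim, fun _ _ _ h => h.elim⟩
  · intro F a ha ih h
    simp only [card_insert R ha] at h
    obtain ⟨G, hGS, hG, hFG⟩ := ih fun G hG => by linarith [h G hG]
    have hne : ∃ b, b ∈ S ∧ ¬ b ∈ G.1 := by
      by_contra! hc
      have := h G (IntSet.ext fun b => ⟨hGS b, hc b⟩)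
      linarith
    obtain ⟨b, hbS, hbG⟩ := hne
    refine ⟨G.insert b, ?_, ?_, hFG.insert ha hbG⟩
    · rintro x (hx | rfl)
      · exact hGS x hx
      · exact hbS
    · rw [card_insert R hbG, card_insert R ha, hG]

/-- Take the supremum s of the sums over finite subsets of {ε ≤ g}. If that set were infinite, each
such sum could be increased by ε, so s − ε would be an upper bound as well. No counting of terms is
needed. -/
theorem isFinite_of_bddAbove {g : α → Elt R} (hg : IsInternalFun M g) {b ε : Elt R} (hε : 0 < ε)
    (hb : ∀ F : FinSub M α, fsum g F ≤ b) : IsFinite M {a | ε ≤ g a} := by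
  by_contra hinf
  have hT : IsInternalFun M fun s : Elt R => ∃ F : FinSub M α, (∀ a, a ∈ F.1 → ε ≤ g a) ∧
      s = fsum g F := by fun_prop
  obtain ⟨s, hs1, hs2⟩ := hR.out.exists_isLUB _ hT.isInternalSet
    ⟨_, FinSub.empty M α, fun a ha => ha.elim, rfl⟩ ⟨b, by
      rintro _ ⟨F, -, rfl⟩
      exact hb F⟩
  have : s ≤ s - ε := by
    refine hs2 ?_
    rintro _ ⟨F, hF, rfl⟩
    obtain ⟨a, ha, haF⟩ : ∃ a, ε ≤ g a ∧ ¬ a ∈ F.1 := by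
      by_contra! hc
      exact hinf (F.2.subset (IsInternalFun.isInternalSet (P := fun a => ε ≤ g a) (by fun_prop)) hc)
    have h1 : fsum g (F.insert a) ≤ s := by
      refine hs1 ⟨F.insert a, ?_, rfl⟩
      rintro x (hx | rfl)
      · exact hF x hx
      · exact ha
    rw [fsum_insert hg haF] at h1
    linarith
  linarith

end

/-! ### Chains of finite sets -/

/-- Induction on F for all families at once. If no member of the family lies inside F, every member
inside F ∪ {a} contains a, so minimality can be tested after erasing a. -/
theorem FinSub.exists_minimal {D : FinSub M α → Prop} (hD : IsInternalFun M D) {F : FinSub M α}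
    (hF : D F) : ∃ E, D E ∧ ∀ C, D C → (∀ a, a ∈ C.1 → a ∈ E.1) → C = E := by
  refine FinSub.induction (P := fun F : FinSub M α => ∀ D : IntSet M (FinSub M α),
    (∃ C, C ∈ D ∧ ∀ a, a ∈ C.1 → a ∈ F.1) →
    ∃ E, E ∈ D ∧ ∀ C, C ∈ D → (∀ a, a ∈ C.1 → a ∈ E.1) → C = E) (by fun_prop) ?_ ?_ F
    (IntSet.mk D hD) ⟨F, hF, fun _ h => h⟩
  · rintro D ⟨C, hC, h⟩
    exact ⟨C, hC, fun B _ hBC => FinSub.ext fun a =>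
      iff_of_false (fun h' => h a (hBC a h')) fun h' => h a h'⟩
  · rintro F a ha ih D ⟨C, hC, hCF⟩
    by_cases hex : ∃ C, C ∈ D ∧ ∀ a, a ∈ C.1 → a ∈ F.1
    · exact ih D hex
    have key : ∀ C, C ∈ D → (∀ x, x ∈ C.1 → x ∈ (F.insert a).1) → a ∈ C.1 := by
      intro C hC hCF
      by_contra haC
      exact hex ⟨C, hC, fun x hx => (hCF x hx).resolve_right fun h => haC (h ▸ hx)⟩
    obtain ⟨_, ⟨E, hE, hEF, rfl⟩, hmin⟩ := ih (IntSet.mk (fun B => ∃ C, C ∈ D ∧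
      (∀ x, x ∈ C.1 → x ∈ F.1 ∨ x = a) ∧ B = C.erase a) (by fun_prop))
      ⟨C.erase a, ⟨C, hC, hCF, rfl⟩, fun x hx => (hCF x hx.1).resolve_right hx.2⟩
    refine ⟨E, hE, fun B hB hBE => ?_⟩
    have hBF := fun x hx => hEF x (hBE x hx)
    have h := hmin (B.erase a) ⟨B, hB, hBF, rfl⟩ fun x hx => ⟨hBE x hx.1, hx.2⟩
    rw [← FinSub.insert_erase (key B hB hBF), ← FinSub.insert_erase (key E hE hEF), h]

/-- If `Fin(α)` is Dedekind-finite, then a chain of finite sets has a greatest member. -/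
theorem exists_greatest_of_chain (hα : IsDedekindFinite M (FinSub M α)) {D : FinSub M α → Prop}
    (hD : IsInternalFun M D) (hne : ∃ C, D C)
    (hchain : ∀ B C, D B → D C → (∀ a, a ∈ B.1 → a ∈ C.1) ∨ (∀ a, a ∈ C.1 → a ∈ B.1)) :
    ∃ C, D C ∧ ∀ B, D B → ∀ a, a ∈ B.1 → a ∈ C.1 := by
  by_contra! hmax
  -- The successor of C is the least member of the chain not contained in C. It is unique, so the
  -- successor map is definable without choice.
  have hnext : ∀ C, D C → ∃ E, D E ∧ (¬ ∀ a, a ∈ E.1 → a ∈ C.1) ∧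
      ∀ B, D B → (¬ ∀ a, a ∈ B.1 → a ∈ C.1) → ∀ a, a ∈ E.1 → a ∈ B.1 := by
    intro C hC
    obtain ⟨B, hB, a, ha, haC⟩ := hmax C hC
    obtain ⟨E, ⟨hE, hEC⟩, hmin⟩ := FinSub.exists_minimal
      (D := fun E => D E ∧ ¬ ∀ a, a ∈ E.1 → a ∈ C.1) (by fun_prop) ⟨hB, fun h => haC (h a ha)⟩
    refine ⟨E, hE, hEC, fun B hB hBC => ?_⟩
    rcases hchain E B hE hB with h | h
    · exact h
    · rw [hmin B ⟨hB, hBC⟩ h]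
      exact fun _ h => h
  choose! next h1 h2 h3 using hnext
  classical
  have hint : IsInternalFun M fun C => if D C then next C else C := by
    refine IsInternalFun.of_graph (P := fun C E => (D C ∧ D E ∧ (¬ ∀ a, a ∈ E.1 → a ∈ C.1) ∧
      ∀ B, D B → (¬ ∀ a, a ∈ B.1 → a ∈ C.1) → ∀ a, a ∈ E.1 → a ∈ B.1) ∨ (¬ D C ∧ E = C))
      (by fun_prop) fun C E => ?_
    by_cases hC : D C
    · simp only [hC, true_and, not_true, false_and, or_false, if_true]
      constructor
      · rintro ⟨hE, h, h'⟩
        exact FinSub.ext fun a => ⟨h' _ (h1 C hC) (h2 C hC) a, h3 C hC E hE h a⟩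
      · rintro rfl
        exact ⟨h1 C hC, h2 C hC, h3 C hC⟩
    · simp [hC]
  have hsub : ∀ C, D C → ∀ a, a ∈ C.1 → a ∈ (next C).1 := fun C hC =>
    (hchain C _ hC (h1 C hC)).resolve_right (h2 C hC)
  have hmono : ∀ B C, D B → D C → next B = next C → ∀ a, a ∈ B.1 → a ∈ C.1 := by
    intro B C hB hC h
    by_contra hBC
    exact h2 B hB (h ▸ h3 C hC B hB hBC)
  -- Off the chain the map is the identity. On it, if B ⊄ C then the successor of C lies inside B,
  -- so it cannot equal the successor of B.
  have hinj : Function.Injective fun C => if D C then next C else C := by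
    intro B C hBC
    by_cases hB : D B <;> by_cases hC : D C <;> simp only [hB, hC, if_true, if_false] at hBC
    · exact FinSub.ext fun a => ⟨hmono B C hB hC hBC a, hmono C B hC hB hBC.symm a⟩
    · exact (hC (hBC ▸ h1 B hB)).elim
    · exact (hB (hBC ▸ h1 C hC)).elim
    · exact hBC
  obtain ⟨C, hC⟩ := hne
  -- The minimal member E is not a value: a B with successor E would be contained in E, hence equal
  -- to E, and thus contain its own successor.
  obtain ⟨E, hE, hmin⟩ := FinSub.exists_minimal hD hC
  obtain ⟨B, hB⟩ := hα _ hint hinj E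
  by_cases hBD : D B
  · simp only [hBD, if_true] at hB
    have := hmin B hBD (hB ▸ hsub B hBD)
    refine h2 B hBD ?_
    rw [hB, this]
    exact fun _ h => h
  · simp only [hBD, if_false] at hB
    exact hBD (hB ▸ hE)

end

section

variable {M : Type u} [Membership M M] [IsZF M] {α : Type v} {β : Type w}
  [Coded M α] [Coded M β] [IsSmall M α] [IsSmall M β]

/-! ### Finite blocks -/

/-- The finite set `F ∪ G`. -/
def FinSub.union (F G : FinSub M α) : FinSub M α :=
  ⟨IntSet.mk (fun x => x ∈ F.1 ∨ x ∈ G.1) (by fun_prop), F.2.union G.2⟩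

/-- If `Fin(α)` is Dedekind-finite, then a monotone operation on finite sets that enlarges them
has a fixed point above any given finite set. -/
theorem exists_finite_closed (hα : IsDedekindFinite M (FinSub M α)) {f : FinSub M α → FinSub M α}
    (hf : IsInternalFun M f) (mono : ∀ A B : FinSub M α, (∀ a, a ∈ A.1 → a ∈ B.1) →
      ∀ a, a ∈ (f A).1 → a ∈ (f B).1)
    (infl : ∀ (A : FinSub M α) (a : α), a ∈ A.1 → a ∈ (f A).1) (A : FinSub M α) :
    ∃ F : FinSub M α, (∀ a, a ∈ A.1 → a ∈ F.1) ∧ ∀ a, a ∈ (f F).1 → a ∈ F.1 := by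
  -- The orbit A, f(A), f(f(A)), … as the smallest family containing A and closed under f, with no
  -- indexing by natural numbers.
  let D : FinSub M α → Prop := fun B => ∀ 𝓕 : IntSet M (FinSub M α), A ∈ 𝓕 →
    (∀ B, B ∈ 𝓕 → f B ∈ 𝓕) → B ∈ 𝓕
  have hD : IsInternalFun M D := by
    have : IsInternalFun M fun p : (FinSub M α × IntSet M (FinSub M α)) × FinSub M α => f p.2 :=
      hf.comp (by fun_prop)
    fun_prop
  have hDA : D A := fun _ h _ => h
  have hDf : ∀ B, D B → D (f B) := fun B hB 𝓕 h0 h1 => h1 B (hB 𝓕 h0 h1)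
  have ind : ∀ P : FinSub M α → Prop, IsInternalFun M P → P A →
      (∀ B, D B → P B → P (f B)) → ∀ B, D B → P B := by
    intro P hP h0 h1 B hB
    exact (hB (IntSet.mk (fun B => D B ∧ P B) (by fun_prop)) ⟨hDA, h0⟩
      fun B hB => ⟨hDf B hB.1, h1 B hB.1 hB.2⟩).2
  have hf1 : IsInternalFun M fun p : (FinSub M α × FinSub M α) × α => f p.1.1 :=
    hf.comp (by fun_prop)
  -- The orbit is a chain, by a double induction: monotonicity carries "C ⊆ B or f(B) ⊆ C" from B, C
  -- to their images.
  have key : ∀ B, D B → ∀ C, D C → (∀ a, a ∈ C.1 → a ∈ B.1) ∨ ∀ a, a ∈ (f B).1 → a ∈ C.1 := by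
    refine ind _ (by fun_prop) ?_ ?_
    · refine ind _ (by fun_prop) (Or.inl fun _ h => h) fun C hC _ => Or.inr (mono A C ?_)
      exact ind (fun C => ∀ a, a ∈ A.1 → a ∈ C.1) (by fun_prop) (fun _ h => h)
        (fun B _ hB a ha => infl B a (hB a ha)) C hC
    · intro B hB ih
      refine ind _ ?_ (Or.inl ?_) fun C hC _ => ?_
      · have : IsInternalFun M fun p : FinSub M α × α => f (f B) := by fun_prop
        fun_prop
      · intro a ha
        exact infl B a (ind (fun C => ∀ a, a ∈ A.1 → a ∈ C.1) (by fun_prop) (fun _ h => h)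
          (fun B _ hB a ha => infl B a (hB a ha)) B hB a ha)
      · exact (ih C hC).imp (mono C B) (mono (f B) C)
  obtain ⟨F, hF, hmax⟩ := exists_greatest_of_chain hα hD ⟨A, hDA⟩ fun B C hB hC =>
    (key C hC B hB).imp (fun h => h) fun h a ha => h a (infl C a ha)
  exact ⟨F, hmax A hDA, hmax _ (hDf F hF)⟩

/-! ### Matrices of squared moduli and the finiteness of their components -/

variable {R : M} [Field (Elt R)] [LinearOrder (Elt R)] [IsStrictOrderedRing (Elt R)]
  [hR : Fact (IsRealField R)]

/-- The properties of the squared moduli of the entries of the matrix of a unitary. -/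
structure IsStochastic (w : α → β → Elt R) : Prop where
  internal : IsInternalFun M fun p : α × β => w p.1 p.2
  nonneg : ∀ x y, 0 ≤ w x y
  row_le : ∀ (x : α) (G : FinSub M β), fsum (w x) G ≤ 1
  row_eq : ∀ (x : α) (G : FinSub M β), (∀ y, ¬ y ∈ G.1 → w x y = 0) → fsum (w x) G = 1
  col_bdd : ∀ y : β, ∃ b, ∀ F : FinSub M α, fsum (fun x => w x y) F ≤ b
  col_eq : ∀ (y : β) (F : FinSub M α), (∀ x, ¬ x ∈ F.1 → w x y = 0) →
    fsum (fun x => w x y) F = 1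

/-- `x` and `x'` are in the same component, rows of `w` with nonzero entries in a common column
being linked. -/
def SameBlock (M : Type u) [Membership M M] [IsZF M] {α : Type v} {β : Type w} [Coded M α]
    {R : M} [Field (Elt R)] (w : α → β → Elt R) (x x' : α) : Prop :=
  ∀ S : IntSet M α, x ∈ S → (∀ a b, a ∈ S → (∃ y, w a y ≠ 0 ∧ w b y ≠ 0) → b ∈ S) → x' ∈ S

namespace IsStochastic

variable {w : α → β → Elt R}

omit [IsStrictOrderedRing (Elt R)] hR in
theorem sameBlock_refl (x : α) : SameBlock M w x x := fun _ h _ => h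

omit [IsStrictOrderedRing (Elt R)] hR in
theorem sameBlock_trans {x y z : α} (h1 : SameBlock M w x y) (h2 : SameBlock M w y z) :
    SameBlock M w x z := fun S hx hS => h2 S (h1 S hx hS) hS

-- Links are symmetric, so the complement of a closed set is closed.
omit [IsStrictOrderedRing (Elt R)] hR in
theorem sameBlock_symm {x y : α} (h : SameBlock M w x y) : SameBlock M w y x := by
  intro S hy hS
  by_contra hx
  exact h (IntSet.mk (fun a => ¬ a ∈ S) (by fun_prop)) hx
    (fun a b ha ⟨c, hc⟩ hb => ha (hS b a hb ⟨c, hc.2, hc.1⟩)) hy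

omit [IsStrictOrderedRing (Elt R)] hR in
theorem sameBlock_of_ne_zero {a b : α} {y : β} (ha : w a y ≠ 0) (hb : w b y ≠ 0) :
    SameBlock M w a b := fun S h hS => hS a b h ⟨y, ha, hb⟩

theorem exists_ne_zero_row (hw : IsStochastic w) (x : α) : ∃ y, w x y ≠ 0 := by
  by_contra! h
  have := hw.row_eq x (FinSub.empty M β) fun y _ => h y
  rw [fsum_empty] at this
  exact zero_ne_one this

theorem exists_ne_zero_col (hw : IsStochastic w) (y : β) : ∃ x, w x y ≠ 0 := by
  by_contra! h
  have := hw.col_eq y (FinSub.empty M α) fun x _ => h x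
  rw [fsum_empty] at this
  exact zero_ne_one this

theorem internal_comp (hw : IsStochastic w) {γ : Type x} [Coded M γ] [IsSmall M γ] {f : γ → α}
    {g : γ → β} (hf : IsInternalFun M f) (hg : IsInternalFun M g) :
    IsInternalFun M fun c => w (f c) (g c) :=
  hw.internal.comp (g := fun c => (f c, g c)) (hf.prodMk hg)

theorem sameBlock_internal (hw : IsStochastic w) :
    IsInternalFun M fun p : α × α => SameBlock M w p.1 p.2 := by
  unfold SameBlock
  have hi := hw.internal
  fun_prop

/-- Bounded sums allow only finitely many entries of size at least ε in each row and each column. -/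
theorem isFinite_near (hw : IsStochastic w) {ε : Elt R} (hε : 0 < ε) (x : α) :
    IsFinite M {x' | ∃ y, ε ≤ w x y ∧ ε ≤ w x' y} := by
  have h1 : IsFinite M {y | ε ≤ w x y} :=
    isFinite_of_bddAbove (hw.internal_comp (by fun_prop) (by fun_prop)) hε (hw.row_le x)
  have h2 : ∀ y, IsFinite M {x | ε ≤ w x y} := fun y => by
    obtain ⟨b, hb⟩ := hw.col_bdd y
    exact isFinite_of_bddAbove (hw.internal_comp (by fun_prop) (by fun_prop)) hε hb
  have hi := hw.internal
  exact IsFinite.biUnion ⟨⟨_, h1.isInternalSet⟩, h1⟩ (R := fun y x' => ε ≤ w x' y) (by fun_prop)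
    fun y _ => h2 y

theorem exists_finite_near_closed (hw : IsStochastic w) (hα : IsDedekindFinite M (FinSub M α))
    {ε : Elt R} (hε : 0 < ε) (x : α) :
    ∃ F : FinSub M α, x ∈ F.1 ∧
      ∀ a b, a ∈ F.1 → (∃ y, ε ≤ w a y ∧ ε ≤ w b y) → b ∈ F.1 := by
  have hnear : IsInternalFun M fun p : α × α => ∃ y, ε ≤ w p.1 y ∧ ε ≤ w p.2 y := by
    have hi := hw.internal
    fun_prop
  have hS : ∀ A : FinSub M α,
      IsFinite M {b | b ∈ A.1 ∨ ∃ a, a ∈ A.1 ∧ ∃ y, ε ≤ w a y ∧ ε ≤ w b y} := fun A =>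
    A.2.union (IsFinite.biUnion A hnear fun a _ => hw.isFinite_near hε a)
  have key := exists_finite_closed hα
    (f := fun A => ⟨⟨_, (hS A).isInternalSet⟩, hS A⟩) ?_ ?_ ?_ ((FinSub.empty M α).insert x)
  · obtain ⟨F, hF1, hF2⟩ := key
    exact ⟨F, hF1 x (Or.inr rfl), fun a b ha hab => hF2 b (Or.inr ⟨a, ha, hab⟩)⟩
  · refine .of_val (isInternalFun_intSet ?_)
    change IsInternalFun M fun p : FinSub M α × α => p.2 ∈ p.1.1 ∨
      ∃ a, a ∈ p.1.1 ∧ ∃ y, ε ≤ w a y ∧ ε ≤ w p.2 y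
    have : IsInternalFun M fun q : (FinSub M α × α) × α =>
        ∃ y, ε ≤ w q.2 y ∧ ε ≤ w q.1.2 y :=
      hnear.comp (g := fun q : (FinSub M α × α) × α => (q.2, q.1.2)) (by fun_prop)
    fun_prop
  · rintro A B hAB b (hb | ⟨a, ha, hab⟩)
    · exact Or.inl (hAB b hb)
    · exact Or.inr ⟨a, hAB a ha, hab⟩
  · exact fun A a ha => Or.inl ha

/-- The sets `K ε` of rows reachable from x through entries of size at least ε are finite and
increase as ε decreases. Their chain has a greatest member, and this is closed under all links. -/
theorem isFinite_sameBlock (hw : IsStochastic w) (hα : IsDedekindFinite M (FinSub M α)) (x : α) :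
    IsFinite M {x' | SameBlock M w x x'} := by
  let K : Elt R → α → Prop := fun ε x' => ∀ S : IntSet M α, x ∈ S →
    (∀ a b, a ∈ S → (∃ y, ε ≤ w a y ∧ ε ≤ w b y) → b ∈ S) → x' ∈ S
  have hK : IsInternalFun M fun p : Elt R × α => K p.1 p.2 := by
    have hi := hw.internal
    unfold K
    fun_prop
  have hKanti : ∀ ε δ : Elt R, ε ≤ δ → ∀ x', K δ x' → K ε x' := fun ε δ h x' hx' S hx hS =>
    hx' S hx fun a b ha ⟨y, h1, h2⟩ => hS a b ha ⟨y, h.trans h1, h.trans h2⟩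
  have hKfin : ∀ ε : Elt R, 0 < ε → IsFinite M {x' | K ε x'} := by
    intro ε hε
    obtain ⟨F, hx, hF⟩ := hw.exists_finite_near_closed hα hε x
    exact F.2.subset (IsInternalFun.isInternalSet (hK.comp (g := fun x' => (ε, x'))
      (by fun_prop))) fun x' hx' => hx' F.1 hx hF
  have key := exists_greatest_of_chain hα
    (D := fun A => ∃ ε : Elt R, 0 < ε ∧ ∀ x', x' ∈ A.1 ↔ K ε x') ?_ ?_ ?_
  · obtain ⟨C, ⟨ε, hε, hC⟩, hmax⟩ := key
    refine C.2.subset (IsInternalFun.isInternalSet (hw.sameBlock_internal.comp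
      (g := fun x' => (x, x')) (by fun_prop))) fun x' hx' => hx' C.1 ?_ ?_
    · exact (hC x).2 fun S h _ => h
    · rintro a b ha ⟨y, h1, h2⟩
      have h1' := lt_of_le_of_ne (hw.nonneg a y) h1.symm
      have h2' := lt_of_le_of_ne (hw.nonneg b y) h2.symm
      -- At this threshold the link from a to b is still visible and a is still reachable, so b lies
      -- in `K δ`, which is contained in the greatest member.
      let δ := min ε (min (w a y) (w b y))
      have hδ : 0 < δ := lt_min hε (lt_min h1' h2')
      refine hmax ⟨⟨_, (hKfin δ hδ).isInternalSet⟩, hKfin δ hδ⟩ ⟨δ, hδ, fun _ => Iff.rfl⟩ b ?_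
      have ha' : K δ a := hKanti δ ε (min_le_left _ _) a ((hC a).1 ha)
      exact fun S hx hS => hS a b (ha' S hx hS) ⟨y, (min_le_right _ _).trans (min_le_left _ _),
        (min_le_right _ _).trans (min_le_right _ _)⟩
  · have : IsInternalFun M fun p : (FinSub M α × Elt R) × α => K p.1.2 p.2 :=
      hK.comp (g := fun p : (FinSub M α × Elt R) × α => (p.1.2, p.2)) (by fun_prop)
    clear_value K
    fun_prop
  · exact ⟨⟨⟨_, (hKfin 1 one_pos).isInternalSet⟩, hKfin 1 one_pos⟩, 1, one_pos, fun _ => Iff.rfl⟩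
  · rintro A B ⟨ε, -, hA⟩ ⟨δ, -, hB⟩
    rcases le_total ε δ with h | h
    · exact Or.inr fun a ha => (hA a).2 (hKanti _ _ h a ((hB a).1 ha))
    · exact Or.inl fun a ha => (hB a).2 (hKanti _ _ h a ((hA a).1 ha))

/-- A finite set of rows which is a union of components meets as many columns. -/
theorem exists_equipotent_of_closed (hw : IsStochastic w) (F : FinSub M α)
    (hF : ∀ a b y, a ∈ F.1 → w a y ≠ 0 → w b y ≠ 0 → b ∈ F.1) :
    ∃ G : FinSub M β, (∀ y, y ∈ G.1 ↔ ∃ x, x ∈ F.1 ∧ w x y ≠ 0) ∧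
      Equipotent M F.1.1 G.1.1 := by
  have hi := hw.internal
  have hw1 : ∀ x, IsInternalFun M (w x) := fun x =>
    hw.internal_comp (f := fun _ => x) (g := fun y => y) (by fun_prop) (by fun_prop)
  have hw2 : IsInternalFun M fun p : β × α => w p.2 p.1 :=
    hw.internal_comp (by fun_prop) (by fun_prop)
  have hw3 : ∀ G : FinSub M β, IsInternalFun M fun x => fsum (w x) G := fun G =>
    IsInternalFun.fsum hw.internal (by fun_prop)
  have hw4 : IsInternalFun M fun y => fsum (fun x => w x y) F :=
    IsInternalFun.fsum (g := fun y x => w x y) hw2 (by fun_prop)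
  let S : IntSet M β := IntSet.mk (fun y => ∃ x, x ∈ F.1 ∧ w x y ≠ 0) (by fun_prop)
  -- A column in `S` has its support inside the closed set F, so it contributes exactly 1; then the
  -- order of summation is exchanged.
  have hcard : ∀ G : FinSub M β, (∀ y, y ∈ G.1 → y ∈ S) →
      card R G = fsum (fun x => fsum (w x) G) F := by
    intro G hG
    rw [fsum_comm hw.internal]
    refine fsum_congr (by fun_prop) hw4 G fun y hy => ?_
    obtain ⟨x, hx, hxy⟩ := hG y hy
    refine (hw.col_eq y F fun x' hx' => ?_).symm
    by_contra h
    exact hx' (hF x x' y hx hxy h)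
  have hle : ∀ G : FinSub M β, (∀ y, y ∈ G.1 → y ∈ S) → card R G ≤ card R F := fun G hG =>
    (hcard G hG).trans_le (fsum_le (hw3 G) (by fun_prop) F fun x _ => hw.row_le x G)
  -- Finiteness of `S` is not yet known. The row sums give |F| ≤ |S| in case `S` is finite, which
  -- yields a subset G of `S` of size |F|; a further column in `S` would violate `hle`.
  obtain ⟨G, hGS, hGF, hFG⟩ := exists_equipotent_subset (R := R) S F fun G hG => by
    rw [hcard G fun y hy => hG ▸ hy]
    refine fsum_le (by fun_prop) (hw3 G) F fun x hx => (hw.row_eq x G fun y hy => ?_).ge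
    by_contra h
    exact hy (hG ▸ (⟨x, hx, h⟩ : y ∈ S))
  refine ⟨G, fun y => ⟨hGS y, fun hy => ?_⟩, hFG⟩
  by_contra hyG
  have := hle (G.insert y) fun z hz => by
    rcases hz with hz | rfl
    · exact hGS z hz
    · exact hy
  rw [card_insert R hyG, hGF] at this
  linarith

end IsStochastic

end

/-! ### The Hilbert space `ℓ²(X)` -/

section

variable {M : Type u} [Membership M M] [IsZF M] {α : Type v} [Coded M α] [IsSmall M α]
  {R : M} [Field (Elt R)] [LinearOrder (Elt R)] [IsStrictOrderedRing (Elt R)]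
  [hR : Fact (IsRealField R)]

theorem re_fsum {g : α → Cpx R} (hg : IsInternalFun M g) (F : FinSub M α) :
    (fsum g F).re = fsum (fun a => (g a).re) F := by
  refine FinSub.induction (P := fun F : FinSub M α => (fsum g F).re = fsum (fun a => (g a).re) F)
    (by fun_prop) ?_ ?_ F
  · rw [fsum_empty, fsum_empty, QuadraticAlgebra.re_zero]
  · intro F a ha ih
    rw [fsum_insert hg ha, fsum_insert (by fun_prop) ha, QuadraticAlgebra.re_add, ih]

theorem im_fsum {g : α → Cpx R} (hg : IsInternalFun M g) (F : FinSub M α) :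
    (fsum g F).im = fsum (fun a => (g a).im) F := by
  refine FinSub.induction (P := fun F : FinSub M α => (fsum g F).im = fsum (fun a => (g a).im) F)
    (by fun_prop) ?_ ?_ F
  · rw [fsum_empty, fsum_empty, QuadraticAlgebra.im_zero]
  · intro F a ha ih
    rw [fsum_insert hg ha, fsum_insert (by fun_prop) ha, QuadraticAlgebra.im_add, ih]

theorem re_mul_star_self (z : Cpx R) : (z * star z).re = QuadraticAlgebra.norm z := by
  rw [norm_eq]
  simp

theorem im_mul_star_self (z : Cpx R) : (z * star z).im = 0 := by
  simp
  ring

/-- A triangle inequality for squared moduli, from (a + b)² ≥ 0 in each coordinate; it avoids square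
roots. -/
theorem norm_sub_le (z z' t : Cpx R) : QuadraticAlgebra.norm (z - z') ≤
    2 * QuadraticAlgebra.norm (t - z) + 2 * QuadraticAlgebra.norm (t - z') := by
  simp only [norm_eq, QuadraticAlgebra.re_sub, QuadraticAlgebra.im_sub]
  nlinarith [mul_self_nonneg ((t.re - z.re) + (t.re - z'.re)),
    mul_self_nonneg ((t.im - z.im) + (t.im - z'.im))]

theorem squareSummable_iff {X : M} {η : Elt X → Cpx R} (hη : IsInternalFun M η) :
    SquareSummable R η ↔
      ∃ b, ∀ F : FinSub M (Elt X), fsum (fun x => QuadraticAlgebra.norm (η x)) F ≤ b := by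
  constructor
  · rintro ⟨S, hS, b, hb⟩
    exact ⟨b, fun F => hS.eq_fsum hη.norm F ▸ hb ⟨F, rfl⟩⟩
  · rintro ⟨b, hb⟩
    refine ⟨fsum _, isFinSum_fsum hη.norm, b, ?_⟩
    rintro _ ⟨F, rfl⟩
    exact hb F

instance (X : M) : IsSmall M (L2 R X) := by
  refine IsSmall.subtype (p := fun η : IntFun M (Elt X) (Cpx R) => SquareSummable R η.1) ?_
  have h : IsInternalFun M fun η : IntFun M (Elt X) (Cpx R) =>
      ∃ b, ∀ F : FinSub M (Elt X), fsum (fun x => QuadraticAlgebra.norm (η.1 x)) F ≤ b := by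
    have h1 : IsInternalFun M fun q : ((IntFun M (Elt X) (Cpx R) × Elt R) × FinSub M (Elt X)) ×
        Elt X => QuadraticAlgebra.norm (q.1.1.1.1 q.2) := IsInternalFun.norm (by fun_prop)
    exact .exists (.forall (.le (.fsum (g := fun (q : (IntFun M (Elt X) (Cpx R) × Elt R) ×
      FinSub M (Elt X)) x => QuadraticAlgebra.norm (q.1.1.1 x)) h1 (by fun_prop)) (by fun_prop)))
  exact h.congr_prop fun η => (squareSummable_iff η.2).symm

variable {X Y : M}

theorem L2.internal (η : L2 R X) : IsInternalFun M fun x => η x := η.1.2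

theorem L2.ext {η ζ : L2 R X} (h : ∀ x, η x = ζ x) : η = ζ :=
  Subtype.ext (Subtype.ext (funext h))

theorem IsInternalFun.l2_app {f : α → L2 R X} {g : α → Elt X} (hf : IsInternalFun M f)
    (hg : IsInternalFun M g) : IsInternalFun M fun a => (f a) (g a) := by
  have h : IsInternalFun M fun η : L2 R X => η.1 := isInternalFun_of_code_eq fun _ => rfl
  exact IsInternalFun.app (h.comp hf) hg

theorem fsum_le_of_support {g : α → Elt R} (hg : IsInternalFun M g) (h0 : ∀ a, 0 ≤ g a)
    (F G : FinSub M α) (h : ∀ a, ¬ a ∈ G.1 → g a = 0) : fsum g F ≤ fsum g G :=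
  (fsum_mono hg h0 (F.union G) F fun _ => Or.inl).trans_eq
    (fsum_eq_of_support hg _ G (fun _ => Or.inr) h)

open Classical in
/-- The basis vector `ξ_x`. -/
noncomputable def basis (R : M) [Field (Elt R)] [LinearOrder (Elt R)] [IsStrictOrderedRing (Elt R)]
    [Fact (IsRealField R)] {X : M} (x : Elt X) : L2 R X :=
  ⟨⟨fun x' => if x' = x then 1 else 0, by fun_prop⟩, by
    have hi : IsInternalFun M fun x' : Elt X => if x' = x then (1 : Cpx R) else 0 := by fun_prop
    rw [squareSummable_iff hi]
    refine ⟨_, fun F => fsum_le_of_support hi.norm (fun _ => norm_nonneg' _) F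
      ((FinSub.empty M (Elt X)).insert x) fun a ha => ?_⟩
    have : a ≠ x := fun h => ha (Or.inr h)
    simp [this]⟩

theorem basis_self (x : Elt X) : basis R x x = 1 := if_pos rfl

theorem basis_of_ne {x x' : Elt X} (h : x' ≠ x) : basis R x x' = 0 := if_neg h

theorem basis_internal : IsInternalFun M fun x : Elt X => basis R x := by
  classical
  have h : IsInternalFun M fun x : Elt X => (basis R x).1 := by
    refine isInternalFun_intFun ?_
    change IsInternalFun M fun p : Elt X × Elt X => if p.2 = p.1 then (1 : Cpx R) else 0
    fun_prop
  have : IsSmall M {η : IntFun M (Elt X) (Cpx R) // SquareSummable R η.1} :=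
    inferInstanceAs (IsSmall M (L2 R X))
  exact IsInternalFun.of_val (p := fun η : IntFun M (Elt X) (Cpx R) => SquareSummable R η.1)
    (f := fun x => basis R x) h

theorem HasInner.unique {η ζ : L2 R X} {c d : Cpx R} (hc : HasInner η ζ c)
    (hd : HasInner η ζ d) : c = d := by
  have hi := IsInternalFun.mul_star η.internal ζ.internal
  obtain ⟨S, hS, hc⟩ := hc
  obtain ⟨T, hT, hd⟩ := hd
  by_contra hne
  have hpos : 0 < QuadraticAlgebra.norm (c - d) := lt_of_le_of_ne (norm_nonneg' _) fun h =>
    hne (sub_eq_zero.1 (norm_eq_zero_iff.1 h.symm))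
  -- With n = |c − d|², take ε = n/2 if n ≤ 1, as then 4ε² = n² ≤ n, and ε = 1/2 otherwise.
  obtain ⟨ε, hε, hε'⟩ : ∃ ε : Elt R, 0 < ε ∧ 4 * ε ^ 2 ≤ QuadraticAlgebra.norm (c - d) := by
    set n : Elt R := QuadraticAlgebra.norm (c - d)
    rcases le_total n 1 with h | h
    · exact ⟨n / 2, by linarith, by nlinarith⟩
    · exact ⟨1 / 2, by norm_num, by linarith⟩
  obtain ⟨F, hF⟩ := hc ε hε
  obtain ⟨G, hG⟩ := hd ε hε
  have h1 := hF (F.union G) fun a ha => Or.inl ha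
  have h2 := hG (F.union G) fun a ha => Or.inr ha
  rw [hT.eq_fsum hi, ← hS.eq_fsum hi] at h2
  have := norm_sub_le c d (S (F.union G))
  linarith

theorem hasInner_of_support {η ζ : L2 R X} (F : FinSub M (Elt X))
    (h : ∀ x, ¬ x ∈ F.1 → η x * star (ζ x) = 0) :
    HasInner η ζ (fsum (fun x => η x * star (ζ x)) F) := by
  have hi := IsInternalFun.mul_star η.internal ζ.internal
  refine ⟨_, isFinSum_fsum hi, fun ε hε => ⟨F, fun G hG => ?_⟩⟩
  rw [fsum_eq_of_support hi G F (fun a ha => hG ha) h, sub_self, QuadraticAlgebra.norm_zero]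
  positivity

theorem hasInner_zero {η ζ : L2 R X} (h : ∀ x, η x * star (ζ x) = 0) : HasInner η ζ 0 := by
  have := hasInner_of_support (η := η) (ζ := ζ) (FinSub.empty M (Elt X)) fun x _ => h x
  rwa [fsum_empty] at this

theorem hasInner_basis_right (η : L2 R X) (x : Elt X) : HasInner η (basis R x) (η x) := by
  have := hasInner_of_support (η := η) (ζ := basis R x) ((FinSub.empty M (Elt X)).insert x)
    fun a ha => by
      rw [basis_of_ne fun h => ha (Or.inr h), star_zero, mul_zero]
  rw [fsum_singleton (IsInternalFun.mul_star η.internal (L2.internal _)), basis_self] at this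
  simpa using this

theorem hasInner_basis_left (η : L2 R X) (x : Elt X) :
    HasInner (basis R x) η (star (η x)) := by
  have := hasInner_of_support (η := basis R x) (ζ := η) ((FinSub.empty M (Elt X)).insert x)
    fun a ha => by
      rw [basis_of_ne fun h => ha (Or.inr h), zero_mul]
  rw [fsum_singleton (IsInternalFun.mul_star (L2.internal _) η.internal), basis_self] at this
  simpa using this

theorem hasInner_self_of_support {η : L2 R X} (F : FinSub M (Elt X))
    (h : ∀ x, ¬ x ∈ F.1 → η x = 0) :
    HasInner η η ⟨fsum (fun x => QuadraticAlgebra.norm (η x)) F, 0⟩ := by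
  have hi := IsInternalFun.mul_star η.internal η.internal
  convert hasInner_of_support (η := η) (ζ := η) F fun x hx => by rw [h x hx, zero_mul] using 1
  refine QuadraticAlgebra.ext ?_ ?_
  · rw [re_fsum hi]
    simp only [re_mul_star_self]
  · rw [im_fsum hi]
    simp only [im_mul_star_self, fsum_zero]

theorem hasInner_basis_self (x : Elt X) : HasInner (basis R x) (basis R x) 1 := by
  have := hasInner_basis_right (basis R x) x
  rwa [basis_self] at this

theorem HasInner.fsum_norm_le {η : L2 R X} (h : HasInner η η 1) (F : FinSub M (Elt X)) :
    fsum (fun x => QuadraticAlgebra.norm (η x)) F ≤ 1 := by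
  have hi := IsInternalFun.mul_star η.internal η.internal
  obtain ⟨S, hS, h⟩ := h
  by_contra! hlt
  -- The tolerance is the excess of the sum over 1. Sums over larger sets exceed 1 by at least as
  -- much, contradicting convergence to 1.
  obtain ⟨G, hG⟩ := h _ (sub_pos.2 hlt)
  have h1 := hG (F.union G) fun a ha => Or.inr ha
  have h2 := fsum_mono η.internal.norm (fun x => norm_nonneg' _) (F.union G) F fun _ => Or.inl
  have h3 : (S (F.union G)).re = fsum (fun x => QuadraticAlgebra.norm (η x)) (F.union G) := by
    rw [hS.eq_fsum hi, re_fsum hi]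
    simp only [re_mul_star_self]
  rw [norm_eq, QuadraticAlgebra.re_sub, QuadraticAlgebra.re_one, h3] at h1
  nlinarith [mul_self_nonneg (S (F.union G) - 1).im]

/-! ### The matrix of a unitary -/

namespace IsUnitary

variable {U : L2 R X → L2 R Y}

/-- The adjoint relation ⟨ξ_x, U⁻¹ξ_y⟩ = ⟨Uξ_x, ξ_y⟩. It turns every statement about columns into
one about a vector of ℓ²(X). -/
theorem exists_preimage_basis (hU : IsUnitary U) (y : Elt Y) :
    ∃ v : L2 R X, U v = basis R y ∧ ∀ x, v x = star (U (basis R x) y) := by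
  obtain ⟨v, hv⟩ := hU.bijective.2 (basis R y)
  refine ⟨v, hv, fun x => ?_⟩
  have h := hU.inner _ _ _ (hasInner_basis_left v x)
  rw [hv] at h
  exact ((congrArg star (h.unique (hasInner_basis_right _ y))).symm.trans (star_star (v x))).symm

theorem hasInner_one_unique (hU : IsUnitary U) {r : Elt R} {η : L2 R X} (h : HasInner η η 1)
    (h' : HasInner (U η) (U η) ⟨r, 0⟩) : r = 1 :=
  congrArg QuadraticAlgebra.re (h'.unique (hU.inner _ _ _ h))

theorem entry_internal (hU : IsUnitary U) :
    IsInternalFun M fun p : Elt X × Elt Y => U (basis R p.1) p.2 := by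
  have h1 := hU.internal
  have h2 := basis_internal (R := R) (X := X)
  exact IsInternalFun.l2_app (f := fun p : Elt X × Elt Y => U (basis R p.1))
    (h1.comp (g := fun p : Elt X × Elt Y => basis R p.1) (h2.comp (by fun_prop))) (by fun_prop)

/-- Rows are the vectors Uξ_x and columns the conjugates of U⁻¹ξ_y. Exact sums are claimed only for
finite supports, where the inner product is a finite sum; this is all that the double count uses. -/
theorem isStochastic (hU : IsUnitary U) :
    IsStochastic fun (x : Elt X) (y : Elt Y) => QuadraticAlgebra.norm (U (basis R x) y) where
  internal := hU.entry_internal.norm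
  nonneg x y := norm_nonneg' _
  row_le x := (hU.inner _ _ _ (hasInner_basis_self x)).fsum_norm_le
  row_eq x G hG := hU.hasInner_one_unique (hasInner_basis_self x)
    (hasInner_self_of_support G fun y hy => norm_eq_zero_iff.1 (hG y hy))
  col_bdd y := by
    obtain ⟨v, hv, h⟩ := hU.exists_preimage_basis y
    obtain ⟨b, hb⟩ := (squareSummable_iff v.internal).1 v.2
    refine ⟨b, fun F => ?_⟩
    convert hb F using 2
    funext x
    rw [h, QuadraticAlgebra.norm_star]
  col_eq y F hF := by
    obtain ⟨v, hv, h⟩ := hU.exists_preimage_basis y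
    have h1 := hU.inner _ _ _ (hasInner_self_of_support (η := v) F fun x hx => by
      rw [h, norm_eq_zero_iff.1 (hF x hx), star_zero])
    rw [hv] at h1
    have h2 := congrArg QuadraticAlgebra.re (h1.unique (hasInner_basis_self y))
    simp only [h, QuadraticAlgebra.norm_star] at h2
    exact h2.trans QuadraticAlgebra.re_one

/-- `U` maps `ℓ²(A)` onto `ℓ²(B)` if its matrix vanishes at all `(x, y)` with `x ∈ A ↮ y ∈ B`. -/
theorem image_L2On (hU : IsUnitary U) {A : Set (Elt X)} {B : Set (Elt Y)}
    (h : ∀ x y, U (basis R x) y ≠ 0 → (x ∈ A ↔ y ∈ B)) : U '' L2On R A = L2On R B := by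
  ext θ
  constructor
  · rintro ⟨η, hη, rfl⟩ y hy
    obtain ⟨v, hv, hvx⟩ := hU.exists_preimage_basis y
    -- ⟨Uη, ξ_y⟩ = ⟨η, U⁻¹ξ_y⟩, and the right-hand side vanishes term by term, so no continuity of U
    -- is needed.
    have h1 : HasInner η v 0 := hasInner_zero fun x => by
      by_cases hx : x ∈ A
      · have : U (basis R x) y = 0 := by
          by_contra hne
          exact hy ((h x y hne).1 hx)
        rw [hvx, this, star_zero, star_zero, mul_zero]
      · rw [hη x hx, zero_mul]
    have h2 := hU.inner _ _ _ h1
    rw [hv] at h2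
    exact (hasInner_basis_right _ y).unique h2
  · intro hθ
    obtain ⟨η, rfl⟩ := hU.bijective.2 θ
    refine ⟨η, fun x hx => ?_, rfl⟩
    have h1 := hU.inner _ _ _ (hasInner_basis_right η x)
    refine h1.unique (hasInner_zero fun y => ?_)
    by_cases hy : y ∈ B
    · have : U (basis R x) y = 0 := by
        by_contra hne
        exact hx ((h x y hne).2 hy)
      rw [this, star_zero, mul_zero]
    · rw [hθ y hy, zero_mul]

end IsUnitary

end

/-! ### The block decomposition, and the strongly amorphous case -/

section

variable {M : Type u} [Membership M M] [IsZF M]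
  {R : M} [Field (Elt R)] [LinearOrder (Elt R)] [IsStrictOrderedRing (Elt R)]
  [hR : Fact (IsRealField R)]

theorem isInternalFun_isBlock {X Y : M} {w : Elt X → Elt Y → Elt R} (hw : IsStochastic w) :
    IsInternalFun M fun C : IntSet M (Elt X) => ∃ x, ∀ x', x' ∈ C ↔ SameBlock M w x x' := by
  have hs := hw.sameBlock_internal
  have h : IsInternalFun M fun p : (IntSet M (Elt X) × Elt X) × Elt X =>
      SameBlock M w p.1.2 p.2 :=
    hs.comp (g := fun p : (IntSet M (Elt X) × Elt X) × Elt X => (p.1.2, p.2)) (by fun_prop)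
  exact .exists (.forall (.iff (by fun_prop) h))

/-- The component of a row is a set of the model. -/
theorem exists_block {X Y : M} {w : Elt X → Elt Y → Elt R} (hw : IsStochastic w) (x : Elt X) :
    ∃ C : IntSet M (Elt X), ∀ x', x' ∈ C ↔ SameBlock M w x x' :=
  ⟨IntSet.mk (fun x' => SameBlock M w x x')
    (hw.sameBlock_internal.comp (g := fun x' => (x, x')) (by fun_prop)), fun _ => Iff.rfl⟩

theorem IsUnitary.exists_blocks {X Y : M} {U : L2 R X → L2 R Y} (hU : IsUnitary U)
    (hX : IsDedekindFinite M (FinSub M (Elt X))) :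
    ∃ (Z : M) (A : IntFun M (Elt Z) (IntSet M (Elt X))) (B : IntFun M (Elt Z) (IntSet M (Elt Y))),
      IsPartitionFamily A ∧ IsPartitionFamily B ∧
      ∀ z : Elt Z, IsFinite M (A z).1 ∧ IsFinite M (B z).1 ∧
        U '' (L2On R (A z).1) = L2On R (B z).1 ∧ Equipotent M (A z).1 (B z).1 := by
  have hw := hU.isStochastic
  set w : Elt X → Elt Y → Elt R := fun x y => QuadraticAlgebra.norm (U (basis R x) y) with hwdef
  have hw0 : ∀ x y, w x y ≠ 0 ↔ U (basis R x) y ≠ 0 := fun x y => not_congr norm_eq_zero_iff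
  -- The index set is the set of components itself, and `A` is the map sending each component to
  -- itself.
  obtain ⟨Z, hZ⟩ := (isInternalFun_isBlock hw).isInternalSet
  choose A hA hAz using fun z : Elt Z => (hZ z.1).1 z.2
  -- These representatives are chosen outside the model; they enter only assertions about single
  -- blocks, never a definition of a set.
  choose r hr using hA
  have hAi : IsInternalFun M A := isInternalFun_of_code_eq hAz
  have hi := hw.internal
  have hBi : IsInternalFun M fun p : Elt Z × Elt Y => ∃ x, x ∈ A p.1 ∧ w x p.2 ≠ 0 := by
    clear_value w
    have : IsInternalFun M fun q : (Elt Z × Elt Y) × Elt X => A q.1.1 := hAi.comp (by fun_prop)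
    fun_prop
  have hBi' : ∀ z, IsInternalFun M fun y : Elt Y => ∃ x, x ∈ A z ∧ w x y ≠ 0 := fun z =>
    hBi.comp (g := fun y => (z, y)) (by fun_prop)
  have hAclosed : ∀ z x x' y, w x y ≠ 0 → w x' y ≠ 0 → x ∈ A z → x' ∈ A z := by
    intro z x x' y h h' hx
    rw [hr] at hx ⊢
    exact IsStochastic.sameBlock_trans hx (IsStochastic.sameBlock_of_ne_zero h h')
  have hfin : ∀ z, IsFinite M (A z).1 := by
    intro z
    have := hw.isFinite_sameBlock hX (r z)
    rwa [show {x' | SameBlock M w (r z) x'} = (A z).1 from Set.ext fun x => (hr z x).symm] at this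
  have hAunique : ∀ x z z', x ∈ A z → x ∈ A z' → z = z' := by
    intro x z z' h h'
    rw [hr] at h h'
    refine Subtype.ext ?_
    rw [← hAz z, ← hAz z']
    congr 1
    refine IntSet.ext fun a => ?_
    rw [hr, hr]
    have h1 : SameBlock M w (r z) (r z') :=
      IsStochastic.sameBlock_trans h (IsStochastic.sameBlock_symm h')
    exact ⟨IsStochastic.sameBlock_trans (IsStochastic.sameBlock_symm h1),
      IsStochastic.sameBlock_trans h1⟩
  have hAexists : ∀ x, ∃ z, x ∈ A z := by
    intro x
    obtain ⟨C, hC⟩ := exists_block hw x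
    have hz := (hZ (Coded.code C)).2 ⟨C, ⟨x, hC⟩, rfl⟩
    refine ⟨⟨_, hz⟩, ?_⟩
    rw [show A ⟨_, hz⟩ = C from code_eq_iff.1 (hAz ⟨_, hz⟩), hC]
    exact IsStochastic.sameBlock_refl x
  have hAne : ∀ z, r z ∈ A z := fun z => (hr z _).2 (IsStochastic.sameBlock_refl _)
  refine ⟨Z, ⟨A, hAi⟩, ⟨fun z => IntSet.mk _ (hBi' z), isInternalFun_intSet hBi⟩,
    ⟨fun z => ⟨r z, hAne z⟩, fun x => ?_⟩, ⟨fun z => ?_, fun y => ?_⟩, fun z => ?_⟩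
  · obtain ⟨z, hz⟩ := hAexists x
    exact ⟨z, hz, fun z' hz' => hAunique x z' z hz' hz⟩
  · obtain ⟨y, hy⟩ := hw.exists_ne_zero_row (r z)
    exact ⟨y, r z, hAne z, hy⟩
  · obtain ⟨x, hx⟩ := hw.exists_ne_zero_col y
    obtain ⟨z, hz⟩ := hAexists x
    refine ⟨z, ⟨x, hz, hx⟩, ?_⟩
    rintro z' ⟨x', hz', hx'⟩
    exact hAunique x z' z (hAclosed z' x' x y hx' hx hz') hz
  · obtain ⟨G, hG, hAG⟩ := hw.exists_equipotent_of_closed ⟨A z, hfin z⟩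
      fun a b y ha h h' => hAclosed z a b y h h' ha
    have hGB : G.1 = IntSet.mk _ (hBi' z) := IntSet.ext hG
    have hG2 := G.2
    rw [hGB] at hG2 hAG
    refine ⟨hfin z, hG2, hU.image_L2On fun x y hxy => ⟨fun hx => ?_, ?_⟩, hAG⟩
    · exact ⟨x, hx, (hw0 x y).2 hxy⟩
    · rintro ⟨x', hx', h'⟩
      exact hAclosed z x' x y h' ((hw0 x y).2 hxy) hx'

/-- On a CF amorphous set, a bounded real function is constant outside a finite set. -/
theorem exists_isFinite_ne {X : M} (hX : IsDedekindFinite M (FinSub M (Elt X)))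
    (hX' : IsAmorphous X) {g : Elt X → Elt R} (hg : IsInternalFun M g)
    (hle : ∀ x, g x ≤ 1) (hge : ∀ x, -1 ≤ g x) : ∃ s, IsFinite M {x | g x ≠ s} := by
  have hT : IsInternalFun M fun t : Elt R => ∃ A : FinSub M (Elt X), ∀ x, x ∈ A.1 ↔ g x < t := by
    fun_prop
  have hfin : ∀ {p : Elt X → Prop}, (∃ A : FinSub M (Elt X), ∀ x, x ∈ A.1 ↔ p x) ↔
      IsFinite M {x | p x} := by
    intro p
    constructor
    · rintro ⟨A, hA⟩
      rw [show {x | p x} = A.1.1 from Set.ext fun x => (hA x).symm]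
      exact A.2
    · exact fun h => ⟨⟨⟨_, h.isInternalSet⟩, h⟩, fun _ => Iff.rfl⟩
  -- s is the supremum of the t for which {g < t} is finite; these t are bounded by 1 because X is
  -- infinite.
  obtain ⟨s, hs1, hs2⟩ := hR.out.exists_isLUB _ hT.isInternalSet
    ⟨-1, hfin.2 (isFinite_of_forall_not_mem fun x hx => (hge x).not_gt hx)⟩ ⟨1, by
      rintro t ht
      by_contra! h
      refine hX'.1 ?_
      rw [← show {x | g x < t} = Set.univ from Set.ext fun x =>
        iff_of_true ((hle x).trans_lt h) trivial]
      exact hfin.1 ht⟩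
  have hε : ∀ ε : Elt R, 0 < ε → IsFinite M {x | s + ε ≤ g x ∨ g x ≤ s - ε} := by
    intro ε hε
    refine IsFinite.union (S := {x | s + ε ≤ g x}) (T := {x | g x ≤ s - ε}) ?_ ?_
    -- If this set were not finite, amorphousness would make its complement {g < s + ε} finite,
    -- against the choice of s.
    · have hi : IsInternalFun M fun x => s + ε ≤ g x := by fun_prop
      rcases hX'.2 (IntSet.mk _ hi) with h | h
      · exact h
      · have : s + ε ≤ s := hs1 <| hfin.2 <| by
          rwa [show {x | g x < s + ε} = (IntSet.mk _ hi).1ᶜ from Set.ext fun x => not_le.symm]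
        linarith
    · by_contra hc
      have : s ≤ s - ε := hs2 fun t ht => by
        by_contra! h
        refine hc ((hfin.1 ht).subset (IsInternalFun.isInternalSet
          (P := fun x => g x ≤ s - ε) (by fun_prop)) fun x hx => lt_of_le_of_lt hx h)
      linarith
  -- The finite sets {|g − s| ≥ ε} form a chain as ε varies, and their union is {g ≠ s}; its
  -- greatest member is therefore all of it.
  obtain ⟨C, ⟨ε, -, hC⟩, hmax⟩ := exists_greatest_of_chain hX
    (D := fun A => ∃ ε : Elt R, 0 < ε ∧ ∀ x, x ∈ A.1 ↔ (s + ε ≤ g x ∨ g x ≤ s - ε))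
    (by fun_prop) ⟨_, 1, one_pos, (hfin.2 (hε 1 one_pos)).choose_spec⟩ (by
      rintro A B ⟨ε, -, hA⟩ ⟨δ, -, hB⟩
      simp only [hA, hB]
      rcases le_total ε δ with h | h
      · exact Or.inr fun x hx => hx.imp (fun hx => by linarith) fun hx => by linarith
      · exact Or.inl fun x hx => hx.imp (fun hx => by linarith) fun hx => by linarith)
  refine ⟨s, C.2.subset (IsInternalFun.isInternalSet (P := fun x => g x ≠ s) (by fun_prop))
    fun x hx => ?_⟩
  have hpos : 0 < |g x - s| := abs_pos.2 (sub_ne_zero.2 hx)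
  obtain ⟨B, hB⟩ := hfin.2 (hε _ hpos)
  refine hmax B ⟨_, hpos, hB⟩ x ((hB x).2 ?_)
  rcases le_total 0 (g x - s) with h | h
  · rw [abs_of_nonneg h]
    exact Or.inl (by linarith)
  · rw [abs_of_nonpos h]
    exact Or.inr (by linarith)

/-- In a strongly amorphous CF set, all but finitely many blocks are singletons. -/
theorem exists_finite_singleton_blocks {X Y : M} (hX : IsDedekindFinite M (FinSub M (Elt X)))
    (hX' : IsStronglyRigid X) {w : Elt X → Elt Y → Elt R} (hw : IsStochastic w) :
    ∃ N : FinSub M (Elt X), ∀ x x', ¬ x ∈ N.1 → SameBlock M w x x' → x' = x := by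
  have hQ := hX'.2 (IntSet.mk _ (isInternalFun_isBlock hw)) ⟨?_, fun x => ?_⟩
  · have hfin := IsFinite.biUnion ⟨⟨_, hQ.isInternalSet⟩, hQ⟩ (R := fun C x => x ∈ C)
      (by fun_prop) fun C hC => by
        obtain ⟨⟨x, hx⟩, -⟩ := hC
        have := hw.isFinite_sameBlock hX x
        rwa [show {x' | SameBlock M w x x'} = {x' | x' ∈ C} from
          Set.ext fun x' => (hx x').symm] at this
    refine ⟨⟨⟨_, hfin.isInternalSet⟩, hfin⟩, fun x x' hx hxx' => ?_⟩
    obtain ⟨C, hC⟩ := exists_block hw x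
    have hxC : x ∈ C := (hC x).2 (IsStochastic.sameBlock_refl x)
    by_contra hne
    refine hx ⟨C, ⟨⟨x, hC⟩, ?_⟩, hxC⟩
    rintro ⟨z, hz⟩
    have h1 : x ∈ ({z} : Set (Elt X)) := hz ▸ hxC
    have h2 : x' ∈ ({z} : Set (Elt X)) := hz ▸ (hC x').2 hxx'
    exact hne (h2.trans h1.symm)
  · rintro C ⟨x, hx⟩
    exact ⟨x, (hx x).2 (IsStochastic.sameBlock_refl x)⟩
  · obtain ⟨C, hC⟩ := exists_block hw x
    refine ⟨C, ⟨⟨x, hC⟩, (hC x).2 (IsStochastic.sameBlock_refl x)⟩, ?_⟩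
    rintro D ⟨⟨z, hz⟩, hxD⟩
    rw [hz] at hxD
    refine IntSet.ext fun a => ?_
    rw [hz, hC]
    exact ⟨IsStochastic.sameBlock_trans (IsStochastic.sameBlock_symm hxD),
      IsStochastic.sameBlock_trans hxD⟩

theorem IsUnitary.exists_bijection {X Y : M} {U : L2 R X → L2 R Y} (hU : IsUnitary U)
    (hX : IsDedekindFinite M (FinSub M (Elt X))) (hX' : IsStronglyAmorphous X) :
    Equipotent M (Set.univ : Set (Elt X)) (Set.univ : Set (Elt Y)) ∧
      ∃ (X' : IntSet M (Elt X)) (Y' : IntSet M (Elt Y)),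
        IsFinite M (X'.1)ᶜ ∧ IsFinite M (Y'.1)ᶜ ∧
        ∃ f : X'.1 → Y'.1, IsInternalFun M f ∧ Function.Bijective f ∧
        ∃ c : Cpx R, QuadraticAlgebra.norm c = 1 ∧
        ∀ x : X'.1, ∃ (ξ : L2 R X) (ζ : L2 R Y),
          IsBasisVector x.1 ξ ∧ IsBasisVector (f x).1 ζ ∧ ∀ y, U ξ y = c * ζ y := by
  have hw := hU.isStochastic
  obtain ⟨N, hN⟩ := exists_finite_singleton_blocks hX hX'.2 hw
  have hlink : ∀ {x x' y}, U (basis R x) y ≠ 0 → U (basis R x') y ≠ 0 → ¬ x ∈ N.1 → x' = x :=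
    fun {x x' y} h h' hx => hN x x' hx (IsStochastic.sameBlock_of_ne_zero (y := y)
      (mt norm_eq_zero_iff.1 h) (mt norm_eq_zero_iff.1 h'))
  have hex : ∀ x, ∃ y, U (basis R x) y ≠ 0 := fun x =>
    (hw.exists_ne_zero_row x).imp fun y hy => mt norm_eq_zero_iff.2 hy
  -- For x outside N, the singleton {x} is closed under links, so it is equipotent with the set of
  -- columns it meets.
  have hunique : ∀ {x y y'}, U (basis R x) y ≠ 0 → U (basis R x) y' ≠ 0 → ¬ x ∈ N.1 → y = y' := by
    intro x y y' h h' hx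
    obtain ⟨G, hG, hFG⟩ := hw.exists_equipotent_of_closed ((FinSub.empty M (Elt X)).insert x)
      fun a b z ha hab hb => by
        obtain rfl : a = x := ha.resolve_left fun h => h
        exact Or.inr (hlink (mt norm_eq_zero_iff.2 hab) (mt norm_eq_zero_iff.2 hb) hx)
    obtain ⟨H, hH⟩ := equipotent_iff.1 hFG
    have key : ∀ z, U (basis R x) z ≠ 0 → (x, z) ∈ H := by
      intro z hz
      obtain ⟨a, ha⟩ := hH.right z ((hG z).2 ⟨x, Or.inr rfl, mt norm_eq_zero_iff.1 hz⟩)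
      obtain rfl : a = x := (hH.mem a z ha).1.resolve_left fun h => h
      exact ha
    exact hH.unique x y y' (key y h) (key y' h')
  choose f hf using hex
  have hu := hU.entry_internal
  have hnorm : ∀ x y, QuadraticAlgebra.norm (U (basis R x) y) ≤ 1 := by
    intro x y
    have := hw.row_le x ((FinSub.empty M (Elt Y)).insert y)
    rwa [fsum_singleton ((L2.internal (U (basis R x))).norm)] at this
  classical
  let h : Elt X → Cpx R := fun x => if x ∈ N.1 then 0 else U (basis R x) (f x)
  have hh : IsInternalFun M h := by
    -- f is chosen outside the model, but off N the nonzero coordinate is unique by `hunique`, so h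
    -- has a definable graph.
    refine IsInternalFun.of_graph (P := fun x c => (x ∈ N.1 ∧ c = 0) ∨
      (¬ x ∈ N.1 ∧ ∃ y, U (basis R x) y ≠ 0 ∧ c = U (basis R x) y)) ?_ fun x c => ?_
    · obtain ⟨u, hu'⟩ : ∃ u : Elt X → Elt Y → Cpx R, u = fun x y => U (basis R x) y := ⟨_, rfl⟩
      have hu2 : IsInternalFun M fun p : Elt X × Elt Y => u p.1 p.2 := by rw [hu']; exact hu
      have : IsInternalFun M fun p : Elt X × Cpx R => (p.1 ∈ N.1 ∧ p.2 = 0) ∨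
        (¬ p.1 ∈ N.1 ∧ ∃ y, u p.1 y ≠ 0 ∧ p.2 = u p.1 y) := by fun_prop
      rw [hu'] at this
      exact this
    · by_cases hx : x ∈ N.1
      · simp [h, hx]
      · simp only [hx, false_and, not_false_eq_true, true_and, false_or, h, if_false]
        constructor
        · rintro ⟨y, hy, rfl⟩
          rw [hunique hy (hf x) hx]
        · rintro rfl
          exact ⟨f x, hf x, rfl⟩
  have hle : ∀ x, (h x).re * (h x).re + (h x).im * (h x).im ≤ 1 := by
    intro x
    rw [← norm_eq]
    by_cases hx : x ∈ N.1
    · simp [h, hx]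
    · simp only [h, hx, if_false]
      exact hnorm x (f x)
  obtain ⟨s, hs⟩ := exists_isFinite_ne (R := R) hX hX'.1 (g := fun x => (h x).re) (by fun_prop)
    (fun x => by nlinarith [hle x, mul_self_nonneg (h x).im])
    (fun x => by nlinarith [hle x, mul_self_nonneg (h x).im])
  obtain ⟨t, ht⟩ := exists_isFinite_ne (R := R) hX hX'.1 (g := fun x => (h x).im) (by fun_prop)
    (fun x => by nlinarith [hle x, mul_self_nonneg (h x).re])
    (fun x => by nlinarith [hle x, mul_self_nonneg (h x).re])
  -- The exceptional rows: non-singleton blocks and rows with the wrong multiplier. F is closed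
  -- under links because each row outside N is linked only to itself.
  let F : FinSub M (Elt X) := N.union (FinSub.union ⟨⟨_, hs.isInternalSet⟩, hs⟩
    ⟨⟨_, ht.isInternalSet⟩, ht⟩)
  have hFN : ∀ x, ¬ x ∈ F.1 → ¬ x ∈ N.1 := fun x hx h => hx (Or.inl h)
  have hFc : ∀ x, ¬ x ∈ F.1 → U (basis R x) (f x) = ⟨s, t⟩ := by
    intro x hx
    have h1 : h x = U (basis R x) (f x) := if_neg (hFN x hx)
    rw [← h1]
    refine QuadraticAlgebra.ext ?_ ?_
    · by_contra hne
      exact hx (Or.inr (Or.inl hne))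
    · by_contra hne
      exact hx (Or.inr (Or.inr hne))
  have hFclosed : ∀ {a b y}, a ∈ F.1 → U (basis R a) y ≠ 0 → U (basis R b) y ≠ 0 → b ∈ F.1 := by
    intro a b y ha hay hby
    by_contra hb
    exact hb (hlink hby hay (hFN b hb) ▸ ha)
  obtain ⟨G, hG, hFG⟩ := hw.exists_equipotent_of_closed F fun a b y ha h h' =>
    hFclosed ha (mt norm_eq_zero_iff.2 h) (mt norm_eq_zero_iff.2 h')
  have hG' : ∀ {x y}, U (basis R x) y ≠ 0 → (x ∈ F.1 ↔ y ∈ G.1) := by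
    intro x y hxy
    rw [hG]
    constructor
    · exact fun hx => ⟨x, hx, mt norm_eq_zero_iff.1 hxy⟩
    · rintro ⟨x', hx', h'⟩
      exact hFclosed hx' (mt norm_eq_zero_iff.2 h') hxy
  let X' : IntSet M (Elt X) := IntSet.mk (fun x => ¬ x ∈ F.1) (by fun_prop)
  let Y' : IntSet M (Elt Y) := IntSet.mk (fun y => ¬ y ∈ G.1) (by fun_prop)
  have hne : IsInternalFun M fun p : Elt X × Elt Y => U (basis R p.1) p.2 ≠ 0 := by fun_prop
  let B : IntSet M (Elt X × Elt Y) :=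
    IntSet.mk (fun p => ¬ p.1 ∈ F.1 ∧ U (basis R p.1) p.2 ≠ 0) (.and (by fun_prop) hne)
  have hB : IsBijRel (fun a b => (a, b) ∈ B) (· ∈ X'.1) (· ∈ Y'.1) := by
    refine ⟨?_, ?_, ?_, ?_, ?_⟩
    · rintro x y ⟨hx, hxy⟩
      exact ⟨hx, fun hy => hx ((hG' hxy).2 hy)⟩
    · exact fun x hx => ⟨f x, hx, hf x⟩
    · intro y hy
      obtain ⟨x, hx⟩ := hw.exists_ne_zero_col y
      exact ⟨x, fun h => hy ((hG' (mt norm_eq_zero_iff.2 hx)).1 h), mt norm_eq_zero_iff.2 hx⟩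
    · rintro x y y' ⟨hx, hy⟩ ⟨-, hy'⟩
      exact hunique hy hy' (hFN x hx)
    · rintro x x' y ⟨hx, hy⟩ ⟨-, hy'⟩
      exact (hlink hy hy' (hFN x hx)).symm
  constructor
  · obtain ⟨H, hH⟩ := equipotent_iff.1 hFG
    -- The double-counting bijection between F and G is glued to the bijection `B` between their
    -- complements.
    refine equipotent_iff.2 ⟨IntSet.mk (fun p => p ∈ H ∨ p ∈ B) (by clear_value B; fun_prop),
      ?_, ?_, ?_, ?_, ?_⟩
    · exact fun _ _ _ => ⟨trivial, trivial⟩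
    · intro x _
      by_cases hx : x ∈ F.1
      · exact (hH.left x hx).imp fun _ => Or.inl
      · exact (hB.left x hx).imp fun _ => Or.inr
    · intro y _
      by_cases hy : y ∈ G.1
      · exact (hH.right y hy).imp fun _ => Or.inl
      · exact (hB.right y hy).imp fun _ => Or.inr
    · rintro x y y' (h1 | h1) (h2 | h2)
      · exact hH.unique _ _ _ h1 h2
      · exact ((hB.mem _ _ h2).1 (hH.mem _ _ h1).1).elim
      · exact ((hB.mem _ _ h1).1 (hH.mem _ _ h2).1).elim
      · exact hB.unique _ _ _ h1 h2
    · rintro x x' y (h1 | h1) (h2 | h2)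
      · exact hH.inj _ _ _ h1 h2
      · exact ((hB.mem _ _ h2).2 (hH.mem _ _ h1).2).elim
      · exact ((hB.mem _ _ h1).2 (hH.mem _ _ h2).2).elim
      · exact hB.inj _ _ _ h1 h2
  · obtain ⟨e, he, he', heB⟩ := hB.exists_fun
    refine ⟨X', Y', ?_, ?_, e, he, he', ⟨s, t⟩, ?_, fun x => ⟨basis R x.1, basis R (e x).1,
      ⟨basis_self _, fun _ => basis_of_ne⟩, ⟨basis_self _, fun _ => basis_of_ne⟩, fun y => ?_⟩⟩
    · rw [show X'.1ᶜ = F.1.1 from Set.ext fun x => not_not]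
      exact F.2
    · rw [show Y'.1ᶜ = G.1.1 from Set.ext fun x => not_not]
      exact G.2
    · obtain ⟨x, hx⟩ : ∃ x, ¬ x ∈ F.1 := by
        by_contra! hc
        refine hX'.1.1 ?_
        rw [show (Set.univ : Set (Elt X)) = F.1.1 from Set.ext fun x => iff_of_true trivial (hc x)]
        exact F.2
      -- The row of any x outside F has a single nonzero entry, so row sum 1 forces |c| = 1; such an
      -- x exists as X is infinite.
      have h1 := hw.row_eq x ((FinSub.empty M (Elt Y)).insert (f x)) fun y hy => by
        refine norm_eq_zero_iff.2 ?_
        by_contra hne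
        exact hy (Or.inr (hunique hne (hf x) (hFN x hx)))
      rw [fsum_singleton ((L2.internal (U (basis R x))).norm), hFc x hx] at h1
      exact h1
    · have hex : (e x).1 = f x.1 := hunique (heB x).2 (hf x.1) (hFN x.1 x.2)
      by_cases hy : y = (e x).1
      · rw [hy, basis_self, mul_one, hex]
        exact hFc x.1 x.2
      · rw [basis_of_ne hy, mul_zero]
        by_contra hne
        exact hy (hunique hne (heB x).2 (hFN x.1 x.2))

end

end ZFModel

theorem theoremL {M : Type*} [Membership M M] [IsZF M]
    (R : M) [Field (Elt R)] [LinearOrder (Elt R)] [IsStrictOrderedRing (Elt R)]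
    (hR : IsRealField R)
    (X Y : M) (hX : IsCF X) (U : L2 R X → L2 R Y) (hU : IsUnitary U) :
    (∃ (Z : M) (A : IntFun M (Elt Z) (IntSet M (Elt X)))
        (B : IntFun M (Elt Z) (IntSet M (Elt Y))),
      IsPartitionFamily A ∧ IsPartitionFamily B ∧
      ∀ z : Elt Z, IsFinite M (A z).1 ∧ IsFinite M (B z).1 ∧
        U '' (L2On R (A z).1) = L2On R (B z).1 ∧
        Equipotent M (A z).1 (B z).1) ∧
    (IsStronglyAmorphous X →
      Equipotent M (Set.univ : Set (Elt X)) (Set.univ : Set (Elt Y)) ∧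
      ∃ (X' : IntSet M (Elt X)) (Y' : IntSet M (Elt Y)),
        IsFinite M (X'.1)ᶜ ∧ IsFinite M (Y'.1)ᶜ ∧
        ∃ f : X'.1 → Y'.1, IsInternalFun M f ∧ Function.Bijective f ∧
        ∃ c : Cpx R, QuadraticAlgebra.norm c = 1 ∧
        ∀ x : X'.1, ∃ (ξ : L2 R X) (ζ : L2 R Y),
          IsBasisVector x.1 ξ ∧ IsBasisVector (f x).1 ζ ∧ ∀ y, U ξ y = c * ζ y) := by
  have : Fact (IsRealField R) := ⟨hR⟩
  exact ⟨hU.exists_blocks hX.2, hU.exists_bijection hX.2⟩
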